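/- Let $A\in\mathbb R^{n\times n}$, $B\in\mathbb R^{n\times k}$, let $Q\in\mathbb R^{n\times n}$ be symmetric positive semidefinite and $R\in\mathbb R^{k\times k}$ symmetric positive definite, and let $\gamma\in(0,1)$, $\tau>0$. Let $w_0,w_1,\dots$ be i.i.d. random vectors in $\mathbb R^n$ with mean zero and finite second moments, and put $W=\mathbb E[w_tw_t^\top]$. A (stationary, randomized Markov) policy $\pi$ assigns to each state $x\in\mathbb R^n$ a probability density $\pi(\cdot|x)$ on $\mathbb R^k$, jointly measurable in $(x,u)$. Under $\pi$ one has $x_0=x$, $u_t\sim\pi(\cdot|x_t)$, $x_{t+1}=Ax_t+Bu_t+w_t$, and the value of $\pi$ is $$J_\pi(x)=\mathbb E_\pi\Big[\sum_{t\ge 0}\gamma^t\big(x_t^\top Qx_t+u_t^\top Ru_t+\tau\log\pi(u_t|x_t)\big)\,\Big|\,x_0=x\Big]\in(-\infty,+\infty].$$ Let $J^*(x)=\inf_\pi J_\pi(x)$, and call $\pi$ optimal if $J_\pi(x)=J^*(x)$ for all $x$. For symmetric positive semidefinite $P$ put $$K_P=\gamma(R+\gamma B^\top PB)^{-1}B^\top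 PA,\qquad \Sigma_P=\tfrac{\tau}{2}(R+\gamma B^\top PB)^{-1},$$ and consider the Riccati equation $$P=Q+K_P^\top RK_P+\gamma(A-BK_P)^\top P(A-BK_P).\qquad(\ast)$$ Suppose that $J^*$ is finite on $\mathbb R^n$. (This is the case if $(\sqrt\gamma A,\sqrt\gamma B)$ is stabilizable, i.e. if for some $K\in\mathbb R^{k\times n}$ all complex eigenvalues of $A-BK$ have modulus less than $1/\sqrt\gamma$; it is also the case if $(\ast)$ has a symmetric positive semidefinite solution.) Then $(\ast)$ has a symmetric positive semidefinite solution $P$ that is the smallest one: $P'-P$ is positive semidefinite for each symmetric positive semidefinite solution $P'$. If moreover $(\sqrt\gamma A,Q)$ is detectable, i.e. if for some $L\in\mathbb R^{n\times n}$ all complex eigenvalues of $A-LQ$ have modulus less than $1/\sqrt\gamma$, then $P$ is the only symmetric positive semidefinite solution. With this $P$, $K^*=K_P$ and $\Sigma^*=\Sigma_P$: 1. the Gaussian policy $\pi^*(\cdot|x)=\mathcal N(-K^*x,\Sigma^*)$, $x\in\mathbb R^n$, is optimal among all policies, and it is the only optimal policy: a policy $\pi$ is optimal if and only if $\pi(\cdot|x)$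 has law $\mathcal N(-K^*x,\Sigma^*)$ for every $x$; 2. $J^*(x)=x^\top Px+q$ for all $x\in\mathbb R^n$, where $$q=\frac{1}{1-\gamma}\Big(\operatorname{Tr}\big(\Sigma^*(R+\gamma B^\top PB)\big)-\frac{\tau}{2}\big(k+\log((2\pi)^k\det\Sigma^*)\big)+\gamma\operatorname{Tr}(WP)\Big).$$ -/

import Mathlib

open MeasureTheory ProbabilityTheory Matrix
open scoped ENNReal NNReal

/-- The Euclidean space `ℝᵈ`. -/
abbrev Vec (d : ℕ) := EuclideanSpace ℝ (Fin d)

/-- The quadratic form `vᵀ M v`. -/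
noncomputable def quadForm {d : ℕ} (M : Matrix (Fin d) (Fin d) ℝ) (v : Vec d) : ℝ :=
  v.ofLp ⬝ᵥ (M *ᵥ v.ofLp)

/-- Expectation, with values in the extended reals, of a (not necessarily absolutely convergent)
random series `∑ₜ cₜ`: the expected sum of the positive parts minus the expected sum of the
negative parts. -/
noncomputable def expectedSeries {Ω : Type*} [MeasurableSpace Ω] (μ : Measure Ω)
    (c : ℕ → Ω → ℝ) : EReal :=
  ((∫⁻ ω, ∑' t, ENNReal.ofReal (c t ω) ∂μ : ℝ≥0∞) : EReal) -
    ((∫⁻ ω, ∑' t, ENNReal.ofReal (-c t ω) ∂μ : ℝ≥0∞) : EReal)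

/-- A stationary randomized Markov policy `π(u | x)`, given by probability densities on the action
space `ℝᵏ` which depend measurably on the state `x ∈ ℝⁿ`. -/
structure Policy (n k : ℕ) where
  /-- `density x u` is `π(u | x)`. -/
  density : Vec n → Vec k → ℝ≥0
  measurable_density : Measurable (Function.uncurry density)
  lintegral_density : ∀ x, ∫⁻ u, (density x u : ℝ≥0∞) = 1

namespace Policy

variable {n k : ℕ}

/-- The law `π(· | x)` of the action chosen at the state `x`. -/
noncomputable def kernel (π : Policy n k) : Kernel (Vec n) (Vec k) :=
  Kernel.withDensity (Kernel.const (Vec n) (volume : Measure (Vec k)))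
    (fun x u => (π.density x u : ℝ≥0∞))

theorem kernel_apply (π : Policy n k) (x : Vec n) :
    π.kernel x = (volume : Measure (Vec k)).withDensity (fun u => (π.density x u : ℝ≥0∞)) := by
  have h : Measurable (Function.uncurry (fun x u => (π.density x u : ℝ≥0∞))) :=
    π.measurable_density.coe_nnreal_ennreal
  rw [kernel, Kernel.withDensity_apply _ h, Kernel.const_apply]

instance (π : Policy n k) : IsMarkovKernel π.kernel where
  isProbabilityMeasure x := ⟨by
    rw [kernel_apply, withDensity_apply _ MeasurableSet.univ, Measure.restrict_univ,
      π.lintegral_density x]⟩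

end Policy

/-- The data of a discounted entropy-regularized linear-quadratic control problem with state space
`ℝⁿ` and action space `ℝᵏ`. -/
structure LQC (n k : ℕ) where
  A : Matrix (Fin n) (Fin n) ℝ
  B : Matrix (Fin n) (Fin k) ℝ
  Q : Matrix (Fin n) (Fin n) ℝ
  R : Matrix (Fin k) (Fin k) ℝ
  /-- discount factor -/
  γ : ℝ
  /-- regularization parameter -/
  τ : ℝ
  /-- common law of the independent noises `wₜ` -/
  noise : Measure (Vec n)
  Q_posSemidef : Q.PosSemidef
  R_posDef : R.PosDef
  γ_pos : 0 < γ
  γ_lt_one : γ < 1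
  τ_pos : 0 < τ
  isProbabilityMeasure_noise : IsProbabilityMeasure noise
  noise_memLp : MemLp (fun w => w) 2 noise
  noise_mean : ∫ w, w ∂noise = 0

namespace LQC

variable {n k : ℕ}

instance (S : LQC n k) : IsProbabilityMeasure S.noise := S.isProbabilityMeasure_noise

/-- The second moment matrix `W = 𝔼[w wᵀ]` of the noise. -/
noncomputable def W (S : LQC n k) : Matrix (Fin n) (Fin n) ℝ :=
  Matrix.of fun i j => ∫ w, w i * w j ∂S.noise

/-- The noiseless dynamics `(x, u) ↦ A x + B u`. -/
noncomputable def drift (S : LQC n k) (z : Vec n × Vec k) : Vec n :=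
  WithLp.toLp 2 (S.A *ᵥ z.1.ofLp + S.B *ᵥ z.2.ofLp)

theorem measurable_drift (S : LQC n k) : Measurable S.drift := by
  refine Continuous.measurable ?_
  unfold drift
  fun_prop

/-- The law of the next state `A x + B u + w`, given the state-action pair `(x, u)`. -/
noncomputable def nextState (S : LQC n k) : Kernel (Vec n × Vec k) (Vec n) :=
  (Kernel.deterministic S.drift S.measurable_drift ×ₖ Kernel.const _ S.noise).map
    (fun p => p.1 + p.2)

instance (S : LQC n k) : IsMarkovKernel S.nextState :=
  Kernel.IsMarkovKernel.map _ (by fun_prop)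

/-- The law of the next state-action pair `(x', u')`, where `x' = A x + B u + w` and `u'` is drawn
from `π(· | x')`, given the state-action pair `(x, u)`. -/
noncomputable def nextPair (S : LQC n k) (π : Policy n k) :
    Kernel (Vec n × Vec k) (Vec n × Vec k) :=
  S.nextState ⊗ₖ Kernel.prodMkLeft (Vec n × Vec k) π.kernel

instance (S : LQC n k) (π : Policy n k) : IsMarkovKernel (S.nextPair π) := by
  unfold nextPair; infer_instance

/-- The transition kernel from the history of state-action pairs up to time `t` to the pair at time
`t + 1`; it only depends on the pair at time `t`. -/
noncomputable def historyKernel (S : LQC n k) (π : Policy n k) (t : ℕ) :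
    Kernel ((i : Finset.Iic t) → Vec n × Vec k) (Vec n × Vec k) :=
  (S.nextPair π).comap (fun h => h ⟨t, Finset.mem_Iic.2 le_rfl⟩) (measurable_pi_apply _)

instance (S : LQC n k) (π : Policy n k) (t : ℕ) : IsMarkovKernel (S.historyKernel π t) := by
  unfold historyKernel; infer_instance

/-- The law of the state-action process `((xₜ, uₜ))ₜ` under the policy `π`, started at `x₀ = x`. -/
noncomputable def trajLaw (S : LQC n k) (π : Policy n k) (x : Vec n) :
    Measure (ℕ → Vec n × Vec k) :=
  Kernel.trajMeasure (X := fun _ => Vec n × Vec k) (Measure.dirac x ⊗ₘ π.kernel)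
    (S.historyKernel π)

/-- The regularized stage cost `xᵀ Q x + uᵀ R u + τ log π(u | x)`. -/
noncomputable def stageCost (S : LQC n k) (π : Policy n k) (z : Vec n × Vec k) : ℝ :=
  quadForm S.Q z.1 + quadForm S.R z.2 + S.τ * Real.log (π.density z.1 z.2)

/-- The value function `J_π(x) = 𝔼[∑ₜ γᵗ (xₜᵀ Q xₜ + uₜᵀ R uₜ + τ log π(uₜ | xₜ)) | x₀ = x]`.
As `R` is positive definite, the negative part of the series has finite expectation for every
policy, so that the value is a well-defined element of `(-∞, +∞]`. -/
noncomputable def value (S : LQC n k) (π : Policy n k) (x : Vec n) : EReal :=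
  expectedSeries (S.trajLaw π x) (fun t ω => S.γ ^ t * S.stageCost π (ω t))

/-- The optimal value function `J*(x) = inf_π J_π(x)`. -/
noncomputable def optimalValue (S : LQC n k) (x : Vec n) : EReal :=
  ⨅ π : Policy n k, S.value π x

/-- A policy is optimal if it attains the optimal value at every initial state. -/
def IsOptimal (S : LQC n k) (π : Policy n k) : Prop :=
  ∀ x, S.value π x = S.optimalValue x

/-- `K = γ (R + γ Bᵀ P B)⁻¹ Bᵀ P A`. -/
noncomputable def gain (S : LQC n k) (P : Matrix (Fin n) (Fin n) ℝ) : Matrix (Fin k) (Fin n) ℝ :=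
  S.γ • ((S.R + S.γ • (S.Bᵀ * P * S.B))⁻¹ * S.Bᵀ * P * S.A)

/-- `Σ = (τ / 2) (R + γ Bᵀ P B)⁻¹`. -/
noncomputable def cov (S : LQC n k) (P : Matrix (Fin n) (Fin n) ℝ) : Matrix (Fin k) (Fin k) ℝ :=
  (S.τ / 2) • (S.R + S.γ • (S.Bᵀ * P * S.B))⁻¹

/-- The Riccati equation `P = Q + Kᵀ R K + γ (A - B K)ᵀ P (A - B K)` with
`K = γ (R + γ Bᵀ P B)⁻¹ Bᵀ P A`. -/
def Riccati (S : LQC n k) (P : Matrix (Fin n) (Fin n) ℝ) : Prop :=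
  P = S.Q + (S.gain P)ᵀ * S.R * S.gain P +
    S.γ • ((S.A - S.B * S.gain P)ᵀ * P * (S.A - S.B * S.gain P))

/-- The constant `q`, where `Σ = (τ / 2) (R + γ Bᵀ P B)⁻¹`:
`q = (Tr(Σ (R + γ Bᵀ P B)) - (τ / 2) (k + log ((2 π)ᵏ det Σ)) + γ Tr(W P)) / (1 - γ)`. -/
noncomputable def offset (S : LQC n k) (P : Matrix (Fin n) (Fin n) ℝ) : ℝ :=
  1 / (1 - S.γ) *
    ((S.cov P * (S.R + S.γ • (S.Bᵀ * P * S.B))).trace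
      - S.τ / 2 * (k + Real.log ((2 * Real.pi) ^ k * (S.cov P).det))
      + S.γ * (S.W * P).trace)

/-- Gaussian policies `π(· | x) = 𝒩(-K x, Σ)`. -/
def IsGaussianPolicy (π : Policy n k) (K : Matrix (Fin k) (Fin n) ℝ)
    (Cov : Matrix (Fin k) (Fin k) ℝ) : Prop :=
  ∀ x : Vec n, π.kernel x = multivariateGaussian (WithLp.toLp 2 (-(K *ᵥ x.ofLp))) Cov

/-- All complex eigenvalues of `M` have modulus `< 1 / √γ`. -/
def DiscountStable (γ : ℝ) (M : Matrix (Fin n) (Fin n) ℝ) : Prop :=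
  ∀ z ∈ spectrum ℂ (M.map (algebraMap ℝ ℂ)), γ * ‖z‖ ^ 2 < 1

/-- `(√γ A, √γ B)` is stabilizable. -/
def Stabilizable (S : LQC n k) : Prop :=
  ∃ K : Matrix (Fin k) (Fin n) ℝ, DiscountStable S.γ (S.A - S.B * K)

/-- `(√γ A, Q)` is detectable. -/
def Detectable (S : LQC n k) : Prop :=
  ∃ L : Matrix (Fin n) (Fin n) ℝ, DiscountStable S.γ (S.A - L * S.Q)

end LQC

/-! The proof rests on one exact identity in `[0, ∞]`. Relative to the Gaussian `φ₀` that minimizes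
`uᵀRu + τ log π`, the averaged stage cost is `xᵀQx + τ KL(π(·|x) ‖ φ₀)` minus the constant `τ log
Z₀`. Dropping that constant shifts every value by the same finite number (`value_eq`), and
`relValue` becomes a series of nonnegative terms, so monotone arguments apply without integrability
conditions.

On `xᵀPx + b`, the Bellman operator of any policy gives `xᵀ ric(P) x`, a new constant, and `τ` times
the relative entropy from the policy to `N(-K_P x, Σ_P)` (`bellman_quadForm`). This combines
completion of the square (`quadForm_stage_eq`) with the Gibbs variational identity.

Lower bound: dropping the entropy and iterating from zero, each policy's value dominates the Riccati
iterates `ric^j 0`. They increase in `j`, so finiteness of `J*` makes them converge, by polarization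
and continuity, to a positive semidefinite fixed point `P` (`exists_tendsto_ric_iterate`). Every
other solution dominates the same iterates, so `P` is minimal. A second iteration recovers the
additive constant (`quadForm_add_relOffset_le_relValue`).

Upper bound and uniqueness: for the Gaussian policy the entropy vanishes, so the quadratic function
is a supersolution and dominates the value (`relValue_le`). Conversely, a policy with this value
must have zero entropy term at every state.

Detectability makes the closed loop of `P` stable after scaling by `√γ`
(`tendsto_closedLoop_of_detectable`); iterating the inequality for `P' - P` along it then forces `P'
= P`. Stabilizability bounds the Riccati iterates by the cost of a fixed stabilizing feedback. -/

section QuadForm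

/-! ### Quadratic forms. -/

variable {d e : ℕ}

theorem quadForm_add_left (M N : Matrix (Fin d) (Fin d) ℝ) (v : Vec d) :
    quadForm (M + N) v = quadForm M v + quadForm N v := by
  simp [quadForm, add_mulVec, dotProduct_add]

theorem quadForm_sub_left (M N : Matrix (Fin d) (Fin d) ℝ) (v : Vec d) :
    quadForm (M - N) v = quadForm M v - quadForm N v := by
  simp [quadForm, sub_mulVec, dotProduct_sub]

theorem quadForm_smul_left (c : ℝ) (M : Matrix (Fin d) (Fin d) ℝ) (v : Vec d) :
    quadForm (c • M) v = c * quadForm M v := by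
  simp [quadForm, smul_mulVec, dotProduct_smul]

@[simp]
theorem quadForm_zero_left (v : Vec d) : quadForm (0 : Matrix (Fin d) (Fin d) ℝ) v = 0 := by
  simp [quadForm]

@[simp]
theorem quadForm_zero_right (M : Matrix (Fin d) (Fin d) ℝ) : quadForm M 0 = 0 := by
  simp [quadForm]

theorem quadForm_smul_right (M : Matrix (Fin d) (Fin d) ℝ) (c : ℝ) (v : Vec d) :
    quadForm M (c • v) = c ^ 2 * quadForm M v := by
  simp [quadForm, mulVec_smul]; ring

theorem quadForm_transpose_mul_mul (C : Matrix (Fin e) (Fin d) ℝ) (M : Matrix (Fin e) (Fin e) ℝ)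
    (v : Vec d) : quadForm (Cᵀ * M * C) v = quadForm M (WithLp.toLp 2 (C *ᵥ v.ofLp)) := by
  simp only [quadForm]
  rw [← mulVec_mulVec, ← mulVec_mulVec, dotProduct_mulVec _ Cᵀ, vecMul_transpose]

theorem isSymm_dotProduct_mulVec_comm {M : Matrix (Fin d) (Fin d) ℝ} (hM : Mᵀ = M)
    (v w : Fin d → ℝ) : v ⬝ᵥ (M *ᵥ w) = w ⬝ᵥ (M *ᵥ v) := by
  rw [dotProduct_comm, ← vecMul_transpose, hM, dotProduct_mulVec]

theorem quadForm_add_right {M : Matrix (Fin d) (Fin d) ℝ} (hM : Mᵀ = M) (v w : Vec d) :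
    quadForm M (v + w) = quadForm M v + 2 * (w.ofLp ⬝ᵥ (M *ᵥ v.ofLp)) + quadForm M w := by
  simp only [quadForm, WithLp.ofLp_add, mulVec_add, dotProduct_add, add_dotProduct]
  rw [isSymm_dotProduct_mulVec_comm hM v.ofLp w.ofLp]; ring

theorem quadForm_eq_sum (M : Matrix (Fin d) (Fin d) ℝ) (v : Vec d) :
    quadForm M v = ∑ i, ∑ j, M i j * (v i * v j) := by
  simp only [quadForm, dotProduct, mulVec, Finset.mul_sum]
  exact Finset.sum_congr rfl fun i _ => Finset.sum_congr rfl fun j _ => by ring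

@[fun_prop]
theorem continuous_quadForm (M : Matrix (Fin d) (Fin d) ℝ) : Continuous (quadForm M) := by
  unfold quadForm
  fun_prop

theorem Matrix.PosSemidef.transpose_eq {M : Matrix (Fin d) (Fin d) ℝ} (hM : M.PosSemidef) :
    Mᵀ = M := by
  simpa [Matrix.IsHermitian, conjTranspose] using hM.isHermitian

theorem Matrix.PosSemidef.quadForm_nonneg {M : Matrix (Fin d) (Fin d) ℝ} (hM : M.PosSemidef)
    (v : Vec d) : 0 ≤ quadForm M v := by
  simpa [quadForm] using hM.dotProduct_mulVec_nonneg v.ofLp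

theorem posSemidef_iff_quadForm {M : Matrix (Fin d) (Fin d) ℝ} :
    M.PosSemidef ↔ Mᵀ = M ∧ ∀ v : Vec d, 0 ≤ quadForm M v := by
  refine ⟨fun h => ⟨h.transpose_eq, h.quadForm_nonneg⟩, fun h => ?_⟩
  refine Matrix.PosSemidef.of_dotProduct_mulVec_nonneg ?_ fun v => ?_
  · rw [Matrix.IsHermitian, conjTranspose_eq_transpose_of_trivial, h.1]
  · simpa [quadForm] using h.2 (WithLp.toLp 2 v)

theorem posSemidef_sub_iff {M N : Matrix (Fin d) (Fin d) ℝ} (hM : Mᵀ = M) (hN : Nᵀ = N) :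
    (N - M).PosSemidef ↔ ∀ v : Vec d, quadForm M v ≤ quadForm N v := by
  simp [posSemidef_iff_quadForm, hM, hN, quadForm_sub_left]

/-- Polarization: the entries of a symmetric matrix in terms of its quadratic form. -/
theorem entry_eq_quadForm {M : Matrix (Fin d) (Fin d) ℝ} (hM : Mᵀ = M) (i j : Fin d) :
    M i j = (quadForm M (EuclideanSpace.single i 1 + EuclideanSpace.single j 1)
      - quadForm M (EuclideanSpace.single i 1) - quadForm M (EuclideanSpace.single j 1)) / 2 := by
  rw [quadForm_add_right hM]
  have h : M j i = M i j := congrFun (congrFun hM i) j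
  simp [h]
  ring

theorem eq_of_quadForm_eq {M N : Matrix (Fin d) (Fin d) ℝ} (hM : Mᵀ = M) (hN : Nᵀ = N)
    (h : ∀ v : Vec d, quadForm M v = quadForm N v) : M = N := by
  ext i j
  rw [entry_eq_quadForm hM, entry_eq_quadForm hN, h, h, h]

end QuadForm

/-! ### The Riccati operator as a minimization. -/

namespace LQC

variable {n k : ℕ} (S : LQC n k)

/-- The matrix `R + γ Bᵀ P B`. -/
noncomputable def hess (P : Matrix (Fin n) (Fin n) ℝ) : Matrix (Fin k) (Fin k) ℝ :=
  S.R + S.γ • (S.Bᵀ * P * S.B)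

/-- The right hand side of the Riccati equation. -/
noncomputable def ric (P : Matrix (Fin n) (Fin n) ℝ) : Matrix (Fin n) (Fin n) ℝ :=
  S.Q + (S.gain P)ᵀ * S.R * S.gain P +
    S.γ • ((S.A - S.B * S.gain P)ᵀ * P * (S.A - S.B * S.gain P))

theorem hess_zero : S.hess 0 = S.R := by simp [hess]

theorem posDef_hess {P : Matrix (Fin n) (Fin n) ℝ} (hP : P.PosSemidef) : (S.hess P).PosDef := by
  refine S.R_posDef.add_posSemidef ?_
  have := hP.conjTranspose_mul_mul_same S.B
  rw [conjTranspose_eq_transpose_of_trivial] at this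
  exact this.smul S.γ_pos.le

theorem hess_mul_gain {P : Matrix (Fin n) (Fin n) ℝ} (hP : P.PosSemidef) :
    S.hess P * S.gain P = S.γ • (S.Bᵀ * P * S.A) := by
  have h := (S.posDef_hess hP).isUnit
  rw [Matrix.isUnit_iff_isUnit_det] at h
  change S.hess P * (S.γ • ((S.hess P)⁻¹ * S.Bᵀ * P * S.A)) = _
  rw [Matrix.mul_smul]
  simp only [← Matrix.mul_assoc]
  rw [Matrix.mul_nonsing_inv _ h, Matrix.one_mul]

theorem transpose_ric {P : Matrix (Fin n) (Fin n) ℝ} (hP : Pᵀ = P) : (S.ric P)ᵀ = S.ric P := by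
  simp [ric, transpose_mul, hP, S.Q_posSemidef.transpose_eq, S.R_posDef.posSemidef.transpose_eq,
    Matrix.mul_assoc]

/-- Completion of the square in the deterministic Bellman operator. -/
theorem quadForm_stage_eq {P : Matrix (Fin n) (Fin n) ℝ} (hP : P.PosSemidef) (x : Vec n)
    (u : Vec k) :
    quadForm S.Q x + quadForm S.R u + S.γ * quadForm P (S.drift (x, u)) =
      quadForm (S.ric P) x
        + quadForm (S.hess P) (u - WithLp.toLp 2 (-(S.gain P *ᵥ x.ofLp))) := by
  set K := S.gain P with hK
  have hPt := hP.transpose_eq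
  have hR := S.R_posDef.posSemidef.transpose_eq
  obtain ⟨y, rfl⟩ : ∃ y : Vec k, u = WithLp.toLp 2 (-(K *ᵥ x.ofLp)) + y :=
    ⟨u - WithLp.toLp 2 (-(K *ᵥ x.ofLp)), by abel⟩
  have hd : S.drift (x, WithLp.toLp 2 (-(K *ᵥ x.ofLp)) + y) =
      WithLp.toLp 2 ((S.A - S.B * K) *ᵥ x.ofLp) + WithLp.toLp 2 (S.B *ᵥ y.ofLp) := by
    ext i
    simp [drift, sub_mulVec, mulVec_add, mulVec_neg, mulVec_mulVec]
    ring
  have hneg : quadForm S.R (WithLp.toLp 2 (-(K *ᵥ x.ofLp))) =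
      quadForm S.R (WithLp.toLp 2 (K *ᵥ x.ofLp)) := by
    simp [quadForm, mulVec_neg]
  -- The normal equation `hess P * K = γ BᵀPA` makes the terms linear in the deviation `y` from
  -- `-Kx` cancel.
  have hcross : S.γ * (y.ofLp ⬝ᵥ ((S.Bᵀ * P * (S.A - S.B * K)) *ᵥ x.ofLp)) =
      y.ofLp ⬝ᵥ ((S.R * K) *ᵥ x.ofLp) := by
    have h := S.hess_mul_gain hP
    rw [← hK, hess, Matrix.add_mul] at h
    have h2 : S.R * K = S.γ • (S.Bᵀ * P * (S.A - S.B * K)) := by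
      rw [Matrix.mul_sub, smul_sub, ← h, Matrix.smul_mul]
      simp [Matrix.mul_assoc]
    rw [h2, smul_mulVec, dotProduct_smul, smul_eq_mul]
  rw [hd, quadForm_add_right hR, quadForm_add_right hPt, add_sub_cancel_left, hneg, ric, hess,
    quadForm_add_left, quadForm_add_left, quadForm_add_left, quadForm_smul_left,
    quadForm_smul_left, quadForm_transpose_mul_mul, quadForm_transpose_mul_mul,
    quadForm_transpose_mul_mul, ← hK]
  have e1 : (WithLp.toLp 2 (S.B *ᵥ y.ofLp)).ofLp ⬝ᵥ
      (P *ᵥ (WithLp.toLp 2 ((S.A - S.B * K) *ᵥ x.ofLp)).ofLp) =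
      y.ofLp ⬝ᵥ ((S.Bᵀ * P * (S.A - S.B * K)) *ᵥ x.ofLp) := by
    rw [← mulVec_mulVec, ← mulVec_mulVec, dotProduct_mulVec y.ofLp, vecMul_transpose]
  have e2 : y.ofLp ⬝ᵥ (S.R *ᵥ (WithLp.toLp 2 (-(K *ᵥ x.ofLp))).ofLp) =
      -(y.ofLp ⬝ᵥ ((S.R * K) *ᵥ x.ofLp)) := by
    simp [mulVec_neg, mulVec_mulVec]
  rw [e1, e2, ← hcross]
  ring

theorem posSemidef_ric {P : Matrix (Fin n) (Fin n) ℝ} (hP : P.PosSemidef) :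
    (S.ric P).PosSemidef := by
  refine posSemidef_iff_quadForm.2 ⟨S.transpose_ric hP.transpose_eq, fun v => ?_⟩
  rw [ric, quadForm_add_left, quadForm_add_left, quadForm_smul_left, quadForm_transpose_mul_mul,
    quadForm_transpose_mul_mul]
  have := S.γ_pos
  have := S.Q_posSemidef.quadForm_nonneg v
  have := S.R_posDef.posSemidef.quadForm_nonneg (WithLp.toLp 2 (S.gain P *ᵥ v.ofLp))
  have := hP.quadForm_nonneg (WithLp.toLp 2 ((S.A - S.B * S.gain P) *ᵥ v.ofLp))
  positivity

theorem quadForm_ric_le {P : Matrix (Fin n) (Fin n) ℝ} (hP : P.PosSemidef) (x : Vec n)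
    (u : Vec k) : quadForm (S.ric P) x ≤
      quadForm S.Q x + quadForm S.R u + S.γ * quadForm P (S.drift (x, u)) := by
  rw [S.quadForm_stage_eq hP]
  linarith [(S.posDef_hess hP).posSemidef.quadForm_nonneg
    (u - WithLp.toLp 2 (-(S.gain P *ᵥ x.ofLp)))]

theorem drift_neg_gain (K : Matrix (Fin k) (Fin n) ℝ) (x : Vec n) :
    S.drift (x, WithLp.toLp 2 (-(K *ᵥ x.ofLp))) =
      WithLp.toLp 2 ((S.A - S.B * K) *ᵥ x.ofLp) := by
  ext i
  simp [drift, sub_mulVec, mulVec_neg, mulVec_mulVec]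
  ring

theorem quadForm_ric_le_closedLoop {P : Matrix (Fin n) (Fin n) ℝ} (hP : P.PosSemidef)
    (K : Matrix (Fin k) (Fin n) ℝ) (x : Vec n) : quadForm (S.ric P) x ≤
      quadForm (S.Q + Kᵀ * S.R * K) x +
        S.γ * quadForm P (WithLp.toLp 2 ((S.A - S.B * K) *ᵥ x.ofLp)) := by
  refine (S.quadForm_ric_le hP x (WithLp.toLp 2 (-(K *ᵥ x.ofLp)))).trans_eq ?_
  rw [drift_neg_gain, quadForm_add_left, quadForm_transpose_mul_mul]
  simp [quadForm, mulVec_neg]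

/-- `ric P` is a minimum over controls, so the gain that is optimal for `P'` is a competitor for
`P`. -/
theorem quadForm_ric_mono {P P' : Matrix (Fin n) (Fin n) ℝ} (hP : P.PosSemidef)
    (h : ∀ x : Vec n, quadForm P x ≤ quadForm P' x) (x : Vec n) :
    quadForm (S.ric P) x ≤ quadForm (S.ric P') x := by
  refine (S.quadForm_ric_le_closedLoop hP (S.gain P') x).trans ?_
  rw [ric, quadForm_add_left _ (S.γ • _), quadForm_smul_left, quadForm_transpose_mul_mul]
  have := S.γ_pos
  gcongr
  exact h _

end LQC

/-! ### Densities of Gaussian laws. -/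

section GaussianDensity

variable {d : ℕ}

/-- Both sides have the same characteristic function, by the Gaussian Fourier integral. -/
theorem stdGaussian_eq_withDensity :
    stdGaussian (Vec d) = (volume : Measure (Vec d)).withDensity
      (fun x => ENNReal.ofReal (Real.exp (-(‖x‖ ^ 2 / 2)) / √((2 * Real.pi) ^ d))) := by
  have hC : 0 < √((2 * Real.pi) ^ d) := by positivity
  -- The Fourier formula carries its normalization as a complex power `(π / b) ^ (d / 2)`, here with
  -- `b = 1/2`.
  have hCc : ((Real.pi : ℂ) / (1 / 2 : ℂ)) ^ ((Module.finrank ℝ (Vec d) : ℂ) / 2) =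
      ((√((2 * Real.pi) ^ d) : ℝ) : ℂ) := by
    have h1 : ((Real.pi : ℂ) / (1 / 2 : ℂ)) = ((2 * Real.pi : ℝ) : ℂ) := by push_cast; ring
    have h2 : ((Module.finrank ℝ (Vec d) : ℂ) / 2) = (((d : ℝ) / 2 : ℝ) : ℂ) := by simp
    rw [h1, h2, ← Complex.ofReal_cpow (by positivity), Real.sqrt_eq_rpow, ← Real.rpow_natCast,
      ← Real.rpow_mul (by positivity)]
    congr 2
    ring
  have hb : 0 < (1 / 2 : ℂ).re := by norm_num
  have hint : Integrable (fun x : Vec d =>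
      Real.exp (-(‖x‖ ^ 2 / 2)) / √((2 * Real.pi) ^ d)) := by
    have h := (GaussianFourier.integrable_cexp_neg_mul_sq_norm_add (V := Vec d) hb 0 0).norm
    refine Integrable.div_const (h.congr (ae_of_all _ fun x => ?_)) _
    simp only [Complex.norm_exp, zero_mul, add_zero]
    congr 1
    rw [show (-(1 / 2 : ℂ) * (‖x‖ : ℂ) ^ 2) = ((-(‖x‖ ^ 2 / 2) : ℝ) : ℂ) by push_cast; ring,
      Complex.ofReal_re]
  have : IsFiniteMeasure ((volume : Measure (Vec d)).withDensity
      (fun x => ENNReal.ofReal (Real.exp (-(‖x‖ ^ 2 / 2)) / √((2 * Real.pi) ^ d)))) :=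
    isFiniteMeasure_withDensity_ofReal hint.2
  refine Measure.ext_of_charFun ?_
  ext t
  rw [charFun_stdGaussian, charFun_apply, integral_withDensity_eq_integral_toReal_smul
    (by fun_prop) (ae_of_all _ fun _ => ENNReal.ofReal_lt_top)]
  have h := GaussianFourier.integral_cexp_neg_mul_sq_norm_add (V := Vec d) hb Complex.I t
  rw [hCc] at h
  have h2 : ∀ x : Vec d, (ENNReal.ofReal (Real.exp (-(‖x‖ ^ 2 / 2)) /
        √((2 * Real.pi) ^ d))).toReal • Complex.exp (inner ℝ x t * Complex.I) =
      ((√((2 * Real.pi) ^ d) : ℝ) : ℂ)⁻¹ *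
        Complex.exp (-(1 / 2 : ℂ) * ‖x‖ ^ 2 + Complex.I * inner ℝ t x) := by
    intro x
    rw [ENNReal.toReal_ofReal (by positivity), Complex.exp_add, Complex.real_smul,
      real_inner_comm t x]
    push_cast
    ring_nf
  simp_rw [h2]
  rw [integral_const_mul, h, ← mul_assoc, inv_mul_cancel₀ (by exact_mod_cast hC.ne'), one_mul]
  congr 1
  simp
  ring

/-- The density of the Gaussian law on `ℝᵈ` with mean `m` and covariance matrix `C`. -/
noncomputable def gaussDensity (m : Vec d) (C : Matrix (Fin d) (Fin d) ℝ) (u : Vec d) : ℝ :=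
  Real.exp (-(quadForm C⁻¹ (u - m) / 2)) / √((2 * Real.pi) ^ d * C.det)

theorem gaussDensity_pos (m : Vec d) {C : Matrix (Fin d) (Fin d) ℝ} (hC : C.PosDef) (u : Vec d) :
    0 < gaussDensity m C u := by
  have := hC.det_pos
  unfold gaussDensity
  positivity

theorem continuous_gaussDensity (m : Vec d) (C : Matrix (Fin d) (Fin d) ℝ) :
    Continuous (gaussDensity m C) := by
  have h : Continuous fun u => quadForm C⁻¹ (u - m) :=
    (continuous_quadForm _).comp (continuous_id.sub continuous_const)
  exact (Real.continuous_exp.comp (h.div_const 2).neg).div_const _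

@[fun_prop]
theorem measurable_gaussDensity (m : Vec d) (C : Matrix (Fin d) (Fin d) ℝ) :
    Measurable (gaussDensity m C) :=
  (continuous_gaussDensity m C).measurable

theorem map_withDensity_comp {X Y : Type*} [MeasurableSpace X] [MeasurableSpace Y] {μ : Measure X}
    {f : X → Y} {g : Y → ℝ≥0∞} (hf : Measurable f) (hg : Measurable g) :
    (μ.withDensity (g ∘ f)).map f = (μ.map f).withDensity g := by
  ext s hs
  rw [Measure.map_apply hf hs, withDensity_apply _ (hf hs), withDensity_apply _ hs,
    setLIntegral_map hs hg hf]
  rfl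

-- The law is the image of the standard Gaussian under `x ↦ m + √C x`, and `|det √C| = √(det C)` is
-- the Jacobian.
open scoped MatrixOrder in
theorem multivariateGaussian_eq_withDensity (m : Vec d) {C : Matrix (Fin d) (Fin d) ℝ}
    (hC : C.PosDef) : multivariateGaussian m C =
      (volume : Measure (Vec d)).withDensity (fun u => ENNReal.ofReal (gaussDensity m C u)) := by
  set T := CFC.sqrt C with hT
  have hTT : T * T = C := CFC.sqrt_mul_sqrt_self C hC.posSemidef.nonneg
  have hTt : Tᵀ = T := (Matrix.nonneg_iff_posSemidef.1 (CFC.sqrt_nonneg C)).transpose_eq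
  have hdet : T.det * T.det = C.det := by rw [← det_mul, hTT]
  have hdet0 : T.det ≠ 0 := fun h => hC.det_pos.ne' (by rw [← hdet, h, zero_mul])
  have hsqrt : √C.det = |T.det| := by rw [← hdet, Real.sqrt_mul_self_eq_abs]
  have hunit : IsUnit T.det := isUnit_iff_ne_zero.2 hdet0
  have hTCT : T * C⁻¹ * T = 1 := by
    rw [← hTT, Matrix.mul_inv_rev, ← Matrix.mul_assoc, Matrix.mul_nonsing_inv _ hunit,
      Matrix.one_mul,
      Matrix.nonsing_inv_mul _ hunit]
  let L : Vec d →ₗ[ℝ] Vec d := (toEuclideanCLM (𝕜 := ℝ) T : Vec d →ₗ[ℝ] Vec d)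
  have hL : ∀ x, L x = WithLp.toLp 2 (T *ᵥ x.ofLp) := fun x => rfl
  have hLdet : LinearMap.det L = T.det := by
    rw [show L = Matrix.toLin (EuclideanSpace.basisFun (Fin d) ℝ).toBasis
      (EuclideanSpace.basisFun (Fin d) ℝ).toBasis T from rfl, LinearMap.det_toLin]
  have hLc : Continuous L := (toEuclideanCLM (𝕜 := ℝ) T).continuous
  -- The factor `|det T|` is there to cancel the Jacobian of the affine map.
  let g : Vec d → ℝ≥0∞ := fun u => ENNReal.ofReal (|T.det| * gaussDensity m C u)
  have hg : Measurable g := by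
    fun_prop
  have hf : Measurable (fun x => m + L x) := by fun_prop
  have hcomp : (fun x : Vec d => ENNReal.ofReal (Real.exp (-(‖x‖ ^ 2 / 2)) /
      √((2 * Real.pi) ^ d))) = g ∘ fun x => m + L x := by
    funext x
    have hq : quadForm C⁻¹ (L x) = ‖x‖ ^ 2 := by
      rw [hL, ← quadForm_transpose_mul_mul, hTt, hTCT, quadForm, one_mulVec,
        EuclideanSpace.real_norm_sq_eq]
      simp [dotProduct, sq]
    simp only [g, Function.comp, gaussDensity, add_sub_cancel_left, hq]
    congr 1
    rw [Real.sqrt_mul (by positivity), hsqrt]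
    have : |T.det| ≠ 0 := abs_ne_zero.2 hdet0
    field_simp
  have hvol : (volume : Measure (Vec d)).map (fun x => m + L x) =
      ENNReal.ofReal |(T.det)⁻¹| • (volume : Measure (Vec d)) := by
    rw [show (fun x => m + L x) = (fun y => m + y) ∘ L from rfl,
      ← Measure.map_map (measurable_const_add m) hLc.measurable,
      Measure.map_linearMap_addHaar_eq_smul_addHaar _ (by rwa [hLdet]), hLdet, Measure.map_smul,
      (measurePreserving_add_left volume m).map_eq]
  change (stdGaussian (Vec d)).map (fun x => m + L x) = _
  rw [stdGaussian_eq_withDensity, hcomp, map_withDensity_comp hf hg, hvol,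
    withDensity_smul_measure, ← withDensity_smul _ hg]
  congr 1
  funext u
  simp only [g, Pi.smul_apply, smul_eq_mul]
  rw [← ENNReal.ofReal_mul (abs_nonneg _), ← mul_assoc, ← abs_mul, inv_mul_cancel₀ hdet0, abs_one,
    one_mul]

theorem lintegral_gaussDensity (m : Vec d) {C : Matrix (Fin d) (Fin d) ℝ} (hC : C.PosDef) :
    ∫⁻ u, ENNReal.ofReal (gaussDensity m C u) = 1 := by
  have h := measure_univ (μ := multivariateGaussian m C)
  rwa [multivariateGaussian_eq_withDensity m hC, withDensity_apply _ MeasurableSet.univ,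
    Measure.restrict_univ] at h

theorem lintegral_exp_neg_quadForm {C : Matrix (Fin d) (Fin d) ℝ} (hC : C.PosDef) :
    ∫⁻ u : Vec d, ENNReal.ofReal (Real.exp (-(quadForm C⁻¹ u / 2))) =
      ENNReal.ofReal √((2 * Real.pi) ^ d * C.det) := by
  have hZ : 0 < √((2 * Real.pi) ^ d * C.det) := by
    have := hC.det_pos
    positivity
  have h := lintegral_gaussDensity 0 hC
  rw [← mul_one (ENNReal.ofReal √_), ← h, ← lintegral_const_mul _ (by fun_prop)]
  refine lintegral_congr fun u => ?_
  rw [← ENNReal.ofReal_mul hZ.le, gaussDensity, sub_zero, mul_div_cancel₀ _ hZ.ne']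

end GaussianDensity

/-! ### Initial law of the trajectory, and relative entropy of densities. -/

theorem ProbabilityTheory.Kernel.map_eval_zero_trajMeasure {X : ℕ → Type*}
    [∀ n, MeasurableSpace (X n)] (μ₀ : Measure (X 0)) [IsProbabilityMeasure μ₀]
    (κ : (n : ℕ) → Kernel (Π i : Finset.Iic n, X i) (X (n + 1))) [∀ n, IsMarkovKernel (κ n)] :
    (Kernel.trajMeasure μ₀ κ).map (fun ω => ω 0) = μ₀ := by
  have h := Measure.map_map (μ := Kernel.trajMeasure μ₀ κ)
    (MeasurableEquiv.measurable (MeasurableEquiv.piUnique (fun i : Finset.Iic 0 => X i)))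
    (Preorder.measurable_frestrictLe (X := X) 0)
  refine h.symm.trans ?_
  rw [Kernel.trajMeasure, Measure.map_comp _ _ (by fun_prop), Kernel.traj_map_frestrictLe,
    Kernel.partialTraj_self, Measure.id_comp]
  exact MeasurableEquiv.map_map_symm _

/-- The relative entropy of a density `p` with respect to a density `φ`, as the integral of the
nonnegative function `p log (p / φ) + φ - p`. -/
noncomputable def relEnt {k : ℕ} (p φ : Vec k → ℝ) : ℝ≥0∞ :=
  ∫⁻ u, ENNReal.ofReal (p u * (Real.log (p u) - Real.log (φ u)) + φ u - p u)

/-- Nonnegativity and the equality case of relative entropy both come from `klFun`. The case `p = 0`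
is covered because its logarithm is multiplied by zero. -/
theorem relEnt_integrand_eq {p φ : ℝ} (hφ : 0 < φ) :
    p * (Real.log p - Real.log φ) + φ - p = φ * InformationTheory.klFun (p / φ) := by
  rcases eq_or_ne p 0 with rfl | hp0
  · simp [InformationTheory.klFun]
  · rw [InformationTheory.klFun, Real.log_div hp0 hφ.ne']
    field_simp

theorem relEnt_integrand_nonneg {p φ : ℝ} (hp : 0 ≤ p) (hφ : 0 < φ) :
    0 ≤ p * (Real.log p - Real.log φ) + φ - p := by
  rw [relEnt_integrand_eq hφ]
  exact mul_nonneg hφ.le (InformationTheory.klFun_nonneg (div_nonneg hp hφ.le))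

theorem relEnt_eq_zero_iff {k : ℕ} {p φ : Vec k → ℝ} (hp : Measurable p) (hφ : Measurable φ)
    (hp0 : ∀ u, 0 ≤ p u) (hφ0 : ∀ u, 0 < φ u) : relEnt p φ = 0 ↔ p =ᵐ[volume] φ := by
  rw [relEnt, lintegral_eq_zero_iff (by fun_prop)]
  refine Filter.eventually_congr (ae_of_all _ fun u => ?_)
  rw [Pi.zero_apply, ENNReal.ofReal_eq_zero, relEnt_integrand_eq (hφ0 u)]
  have h1 := InformationTheory.klFun_nonneg (div_nonneg (hp0 u) (hφ0 u).le)
  rw [(mul_nonneg (hφ0 u).le h1).ge_iff_eq', mul_eq_zero, or_iff_right (hφ0 u).ne',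
    InformationTheory.klFun_eq_zero_iff (div_nonneg (hp0 u) (hφ0 u).le),
    div_eq_one_iff_eq (hφ0 u).ne']

namespace Policy

variable {n k : ℕ} (π : Policy n k)

@[fun_prop]
theorem measurable_density_right (x : Vec n) : Measurable (π.density x) :=
  π.measurable_density.of_uncurry_left

theorem lintegral_kernel (x : Vec n) {f : Vec k → ℝ≥0∞} (hf : Measurable f) :
    ∫⁻ u, f u ∂π.kernel x = ∫⁻ u, (π.density x u : ℝ≥0∞) * f u := by
  rw [kernel_apply, lintegral_withDensity_eq_lintegral_mul _ (by fun_prop) hf]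
  rfl

end Policy

/-! ### Partition functions, the transition operator and the normalized value. -/

namespace LQC

variable {n k : ℕ} (S : LQC n k)

theorem cov_eq (P : Matrix (Fin n) (Fin n) ℝ) : S.cov P = (S.τ / 2) • (S.hess P)⁻¹ := rfl

theorem posDef_cov {P : Matrix (Fin n) (Fin n) ℝ} (hP : P.PosSemidef) : (S.cov P).PosDef :=
  (S.posDef_hess hP).inv.smul (half_pos S.τ_pos)

theorem inv_cov {P : Matrix (Fin n) (Fin n) ℝ} (hP : P.PosSemidef) :
    (S.cov P)⁻¹ = (2 / S.τ) • S.hess P := by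
  have h := (S.posDef_hess hP).isUnit
  rw [Matrix.isUnit_iff_isUnit_det] at h
  have hτ := S.τ_pos
  refine Matrix.inv_eq_right_inv ?_
  rw [cov_eq, Matrix.smul_mul, Matrix.mul_smul, Matrix.nonsing_inv_mul _ h, smul_smul,
    show S.τ / 2 * (2 / S.τ) = 1 by field_simp, one_smul]

/-- The logarithm of the partition function `∫ exp (-uᵀ (R + γ Bᵀ P B) u / τ) du`. -/
noncomputable def logPartition (P : Matrix (Fin n) (Fin n) ℝ) : ℝ :=
  Real.log √((2 * Real.pi) ^ k * (S.cov P).det)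

theorem log_gaussDensity {P : Matrix (Fin n) (Fin n) ℝ} (hP : P.PosSemidef) (m u : Vec k) :
    S.τ * Real.log (gaussDensity m (S.cov P) u) =
      -quadForm (S.hess P) (u - m) - S.τ * S.logPartition P := by
  have hτ := S.τ_pos
  have hZ : 0 < √((2 * Real.pi) ^ k * (S.cov P).det) := by
    have := (S.posDef_cov hP).det_pos
    positivity
  rw [gaussDensity, Real.log_div (Real.exp_pos _).ne' hZ.ne', Real.log_exp, S.inv_cov hP,
    quadForm_smul_left, logPartition]
  field_simp

/-- Since `hess P ≥ R`, the integrand of the partition function is pointwise smaller than for `P =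
0`. This keeps the additive constants of value iteration nonnegative. -/
theorem logPartition_le_logPartition_zero {P : Matrix (Fin n) (Fin n) ℝ} (hP : P.PosSemidef) :
    S.logPartition P ≤ S.logPartition 0 := by
  have hτ := S.τ_pos
  have hZ : 0 < √((2 * Real.pi) ^ k * (S.cov P).det) := by
    have := (S.posDef_cov hP).det_pos
    positivity
  refine Real.log_le_log hZ ?_
  rw [← ENNReal.ofReal_le_ofReal_iff (Real.sqrt_nonneg _),
    ← lintegral_exp_neg_quadForm (S.posDef_cov hP),
    ← lintegral_exp_neg_quadForm (S.posDef_cov Matrix.PosSemidef.zero)]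
  refine lintegral_mono fun u => ENNReal.ofReal_le_ofReal (Real.exp_le_exp.2 ?_)
  rw [S.inv_cov hP, S.inv_cov Matrix.PosSemidef.zero, hess_zero, hess, quadForm_smul_left,
    quadForm_smul_left, quadForm_add_left, quadForm_smul_left, quadForm_transpose_mul_mul]
  have h1 := mul_nonneg S.γ_pos.le (hP.quadForm_nonneg (WithLp.toLp 2 (S.B *ᵥ u.ofLp)))
  have h2 : 0 < 2 / S.τ := by positivity
  nlinarith [mul_nonneg h2.le h1]

theorem lintegral_nextState (z : Vec n × Vec k) {f : Vec n → ℝ≥0∞} (hf : Measurable f) :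
    ∫⁻ y, f y ∂S.nextState z = ∫⁻ w, f (S.drift z + w) ∂S.noise := by
  have hf' : Measurable fun p : Vec n × Vec n => f (p.1 + p.2) := hf.comp (by fun_prop)
  rw [nextState, Kernel.lintegral_map _ (by fun_prop) _ hf, Kernel.lintegral_prod _ _ _ hf',
    Kernel.lintegral_deterministic' _ (by fun_prop), Kernel.const_apply]

/-- The expectation of `f` at the next state, as a function of the current state. -/
noncomputable def transOp (π : Policy n k) (f : Vec n → ℝ≥0∞) (x : Vec n) : ℝ≥0∞ :=
  ∫⁻ u, ∫⁻ y, f y ∂S.nextState (x, u) ∂π.kernel x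

theorem measurable_transOp (π : Policy n k) {f : Vec n → ℝ≥0∞} (hf : Measurable f) :
    Measurable (S.transOp π f) :=
  Measurable.lintegral_kernel_prod_right' (f := fun p => ∫⁻ y, f y ∂S.nextState p)
    hf.lintegral_kernel

theorem measurable_transOp_iterate (π : Policy n k) {f : Vec n → ℝ≥0∞} (hf : Measurable f)
    (t : ℕ) : Measurable ((S.transOp π)^[t] f) := by
  induction t generalizing f with
  | zero => exact hf
  | succ t ih => exact ih (S.measurable_transOp π hf)

theorem lintegral_kernel_nextPair (π : Policy n k) {F : Vec n × Vec k → ℝ≥0∞} (hF : Measurable F)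
    (x : Vec n) : ∫⁻ u, ∫⁻ z, F z ∂S.nextPair π (x, u) ∂π.kernel x =
      S.transOp π (fun y => ∫⁻ u, F (y, u) ∂π.kernel y) x := by
  rw [transOp]
  refine lintegral_congr fun u => ?_
  rw [nextPair, Kernel.lintegral_compProd _ _ _ hF]
  rfl

/-- Reduces the path measure to powers of an operator on functions of the state. The induction
integrates out the last transition, which changes `F`, so `F` is kept general. -/
theorem lintegral_trajLaw_eval (π : Policy n k) (x : Vec n) (t : ℕ) {F : Vec n × Vec k → ℝ≥0∞}
    (hF : Measurable F) : ∫⁻ ω, F (ω t) ∂S.trajLaw π x =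
      (S.transOp π)^[t] (fun y => ∫⁻ u, F (y, u) ∂π.kernel y) x := by
  induction t generalizing F with
  | zero =>
    rw [← lintegral_map (f := F) (g := fun ω : ℕ → Vec n × Vec k => ω 0) hF (by fun_prop), trajLaw,
      Kernel.map_eval_zero_trajMeasure (X := fun _ => Vec n × Vec k),
      Measure.lintegral_compProd hF, lintegral_dirac' _
        (Measurable.lintegral_kernel_prod_right' hF)]
    rfl
  | succ t ih =>
    have h := Kernel.map_frestrictLe_trajMeasure_compProd_eq_map_trajMeasure
      (X := fun _ => Vec n × Vec k) (μ₀ := Measure.dirac x ⊗ₘ π.kernel) (κ := S.historyKernel π)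
      (a := t)
    have h2 := congrArg (fun μ => ∫⁻ p, F p.2 ∂μ) h
    rw [lintegral_map (by fun_prop) (by fun_prop), Measure.lintegral_compProd (by fun_prop),
      lintegral_map (Measurable.lintegral_kernel_prod_right'
        (f := fun p : ((i : Finset.Iic t) → Vec n × Vec k) × (Vec n × Vec k) => F p.2)
        (by fun_prop)) (by fun_prop)] at h2
    rw [Function.iterate_succ_apply]
    have h3 := ih (F := fun z => ∫⁻ z', F z' ∂S.nextPair π z) hF.lintegral_kernel
    simp only [S.lintegral_kernel_nextPair π hF] at h3
    rw [trajLaw] at h3 ⊢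
    rw [← h2, ← h3]
    rfl

/-- The stage cost averaged over the action, up to an additive constant: the cost of the state plus
`τ` times the relative entropy with respect to the minimizer of the stage cost. -/
noncomputable def runningCost (π : Policy n k) (x : Vec n) : ℝ≥0∞ :=
  ENNReal.ofReal (quadForm S.Q x) +
    ENNReal.ofReal S.τ * relEnt (fun u => π.density x u) (gaussDensity 0 (S.cov 0))

theorem measurable_relEnt_density (π : Policy n k) (φ : Vec k → ℝ) (hφ : Measurable φ) :
    Measurable fun x => relEnt (fun u => π.density x u) φ := by
  unfold relEnt
  have h : Measurable fun p : Vec n × Vec k => (π.density p.1 p.2 : ℝ) :=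
    π.measurable_density.coe_nnreal_real
  exact Measurable.lintegral_prod_right' (f := fun p : Vec n × Vec k =>
    ENNReal.ofReal ((π.density p.1 p.2 : ℝ) * (Real.log (π.density p.1 p.2) - Real.log (φ p.2))
      + φ p.2 - (π.density p.1 p.2 : ℝ))) (by fun_prop)

theorem measurable_runningCost (π : Policy n k) : Measurable (S.runningCost π) := by
  have h := measurable_relEnt_density π (gaussDensity 0 (S.cov 0)) (by fun_prop)
  have h2 := (continuous_quadForm S.Q).measurable
  unfold runningCost
  fun_prop

/-- The value function, normalized to be nonnegative. -/
noncomputable def relValue (π : Policy n k) (x : Vec n) : ℝ≥0∞ :=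
  ∑' t, ENNReal.ofReal S.γ ^ t * (S.transOp π)^[t] (S.runningCost π) x

end LQC

/-! ### Stage costs as relative entropies; Bellman equation of a policy. -/

namespace LQC

variable {n k : ℕ} (S : LQC n k)

theorem stageCost_eq (π : Policy n k) (x : Vec n) (u : Vec k) :
    S.stageCost π (x, u) = quadForm S.Q x +
      S.τ * (Real.log (π.density x u) - Real.log (gaussDensity 0 (S.cov 0) u))
        - S.τ * S.logPartition 0 := by
  have h := S.log_gaussDensity Matrix.PosSemidef.zero 0 u
  rw [hess_zero, sub_zero] at h
  rw [stageCost, mul_sub, h]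
  ring

@[fun_prop]
theorem measurable_stageCost (π : Policy n k) : Measurable (S.stageCost π) := by
  have h : Measurable fun p : Vec n × Vec k => (π.density p.1 p.2 : ℝ) :=
    π.measurable_density.coe_nnreal_real
  have h1 := (continuous_quadForm S.Q).measurable
  have h2 := (continuous_quadForm S.R).measurable
  unfold stageCost
  fun_prop

theorem lintegral_density_mul_const (π : Policy n k) (x : Vec n) (c : ℝ≥0∞) :
    ∫⁻ u, (π.density x u : ℝ≥0∞) * c = c := by
  rw [lintegral_mul_const _ (by fun_prop), π.lintegral_density, one_mul]

/-- Says that the mean stage cost is `runningCost - τ log Z₀`, with all subtractions moved across so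
that it makes sense in `[0, ∞]`. The two copies of `τ` are the masses of `φ` and of the policy
density, from the term `φ - p` in the entropy integrand. -/
theorem lintegral_stageCost_pos_add (π : Policy n k) (x : Vec n) :
    ∫⁻ u, ENNReal.ofReal (S.stageCost π (x, u)) ∂π.kernel x +
        (ENNReal.ofReal S.τ + ENNReal.ofReal (S.τ * S.logPartition 0)) =
      ∫⁻ u, ENNReal.ofReal (-S.stageCost π (x, u)) ∂π.kernel x + (S.runningCost π x +
        (ENNReal.ofReal S.τ + ENNReal.ofReal (-(S.τ * S.logPartition 0)))) := by
  have hτ := S.τ_pos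
  have hcov := S.posDef_cov (n := n) Matrix.PosSemidef.zero
  set φ := gaussDensity 0 (S.cov 0) with hφ
  set D := S.τ * S.logPartition 0 with hD
  have key : ∀ u, (π.density x u : ℝ≥0∞) * ENNReal.ofReal (S.stageCost π (x, u)) +
        (ENNReal.ofReal S.τ * ENNReal.ofReal (φ u) + (π.density x u : ℝ≥0∞) * ENNReal.ofReal D) =
      (π.density x u : ℝ≥0∞) * ENNReal.ofReal (-S.stageCost π (x, u)) +
        (((π.density x u : ℝ≥0∞) * ENNReal.ofReal (quadForm S.Q x) +
          ENNReal.ofReal S.τ * ENNReal.ofReal (π.density x u *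
            (Real.log (π.density x u) - Real.log (φ u)) + φ u - π.density x u)) +
        ((π.density x u : ℝ≥0∞) * ENNReal.ofReal S.τ +
          (π.density x u : ℝ≥0∞) * ENNReal.ofReal (-D))) := by
    intro u
    have hQ := S.Q_posSemidef.quadForm_nonneg x
    have hφu := gaussDensity_pos 0 hcov u
    have hc := S.stageCost_eq π x u
    rw [← hφ] at hφu hc
    rw [← hD] at hc
    have hkl := relEnt_integrand_nonneg (π.density x u).2 hφu
    rw [NNReal.val_eq_coe] at hkl
    have hp : 0 ≤ (π.density x u : ℝ) := (π.density x u).2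
    have h1 := max_zero_sub_max_neg_zero_eq_self (S.stageCost π (x, u))
    have h2 := max_zero_sub_max_neg_zero_eq_self D
    have h3 : ∀ c : ℝ, 0 ≤ max c 0 := fun c => le_max_right _ _
    -- Making the truncation in `ENNReal.ofReal` explicit leaves only nonnegative reals, so the
    -- claim becomes an identity in `ℝ`.
    have hmax : ∀ c : ℝ, ENNReal.ofReal c = ENNReal.ofReal (max c 0) := by
      intro c; rw [ENNReal.ofReal_max]; simp
    rw [hmax (S.stageCost π (x, u)), hmax (-S.stageCost π (x, u)), hmax D, hmax (-D),
      ← ENNReal.ofReal_coe_nnreal]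
    have hc1 := h3 (S.stageCost π (x, u))
    have hc2 := h3 (-S.stageCost π (x, u))
    have hd1 := h3 D
    have hd2 := h3 (-D)
    replace h1 := h1.trans hc
    generalize max (S.stageCost π (x, u)) 0 = c1, max (-S.stageCost π (x, u)) 0 = c2,
      max D 0 = d1, max (-D) 0 = d2 at *
    obtain ⟨r, hr⟩ : ∃ r, (π.density x u : ℝ) * (Real.log (π.density x u) - Real.log (φ u))
      + φ u - π.density x u = r := ⟨_, rfl⟩
    rw [hr] at hkl ⊢
    repeat rw [← ENNReal.ofReal_mul (by positivity)]
    repeat rw [← ENNReal.ofReal_add (by positivity) (by positivity)]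
    congr 1
    rw [← hr]
    linear_combination (π.density x u : ℝ) * h1 + (π.density x u : ℝ) * h2
  have hint := lintegral_congr (μ := volume) key
  have hm : Measurable fun u => S.stageCost π (x, u) := by fun_prop
  have hmd : Measurable fun u => (π.density x u : ℝ≥0∞) := by fun_prop
  have hmφ : Measurable φ := by fun_prop
  rw [lintegral_add_left (by fun_prop), lintegral_add_left (by fun_prop),
    lintegral_add_left (by fun_prop), lintegral_add_right _ (by fun_prop),
    lintegral_add_left (by fun_prop), lintegral_add_left (by fun_prop),
    lintegral_density_mul_const, lintegral_density_mul_const, lintegral_density_mul_const,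
    lintegral_density_mul_const, lintegral_const_mul _ (by fun_prop),
    lintegral_const_mul _ (by fun_prop), lintegral_gaussDensity 0 hcov, mul_one] at hint
  rw [π.lintegral_kernel x (by fun_prop), π.lintegral_kernel x (by fun_prop), hint]
  rfl

/-- From `p log (p/φ) ≥ p - φ ≥ -φ`, the negative part is bounded uniformly in policy and state;
hence values never involve `∞ - ∞`. -/
theorem lintegral_stageCost_neg_le (π : Policy n k) (x : Vec n) :
    ∫⁻ u, ENNReal.ofReal (-S.stageCost π (x, u)) ∂π.kernel x ≤
      ENNReal.ofReal S.τ + ENNReal.ofReal (S.τ * S.logPartition 0) := by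
  have hτ := S.τ_pos
  have hcov := S.posDef_cov (n := n) Matrix.PosSemidef.zero
  have hm : Measurable fun u => S.stageCost π (x, u) := by fun_prop
  set φ := gaussDensity 0 (S.cov 0) with hφ
  set D := S.τ * S.logPartition 0 with hD
  have hmφ : Measurable φ := by fun_prop
  rw [π.lintegral_kernel x (by fun_prop)]
  calc _ ≤ ∫⁻ u, ENNReal.ofReal S.τ * ENNReal.ofReal (φ u)
        + (π.density x u : ℝ≥0∞) * ENNReal.ofReal D := lintegral_mono fun u => ?_
    _ = _ := by
      rw [lintegral_add_left (by fun_prop), lintegral_density_mul_const,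
        lintegral_const_mul _ (by fun_prop), lintegral_gaussDensity 0 hcov, mul_one]
  have hQ := S.Q_posSemidef.quadForm_nonneg x
  have hφu := gaussDensity_pos 0 hcov u
  have hc := S.stageCost_eq π x u
  rw [← hφ] at hφu hc
  rw [← hD] at hc
  have hkl := relEnt_integrand_nonneg (π.density x u).2 hφu
  rw [NNReal.val_eq_coe] at hkl
  have hp : 0 ≤ (π.density x u : ℝ) := (π.density x u).2
  have h1 : D ≤ max D 0 := le_max_left _ _
  have h2 : 0 ≤ max D 0 := le_max_right _ _
  have hmax : ENNReal.ofReal D = ENNReal.ofReal (max D 0) := by rw [ENNReal.ofReal_max]; simp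
  rw [hmax, ← ENNReal.ofReal_coe_nnreal]
  repeat rw [← ENNReal.ofReal_mul (by positivity)]
  rw [← ENNReal.ofReal_add (by positivity) (by positivity)]
  refine ENNReal.ofReal_le_ofReal ?_
  rw [hc]
  nlinarith [mul_nonneg hτ.le hkl, mul_nonneg hp hQ, mul_nonneg hp (sub_nonneg.2 h1),
    mul_nonneg hτ.le hp]

theorem transOp_const (π : Policy n k) (c : ℝ≥0∞) (x : Vec n) :
    S.transOp π (fun _ => c) x = c := by
  simp [transOp]

theorem transOp_mono (π : Policy n k) {f g : Vec n → ℝ≥0∞} (h : ∀ x, f x ≤ g x) (x : Vec n) :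
    S.transOp π f x ≤ S.transOp π g x :=
  lintegral_mono fun _ => lintegral_mono h

theorem transOp_add (π : Policy n k) {f g : Vec n → ℝ≥0∞} (hf : Measurable f) (x : Vec n) :
    S.transOp π (fun y => f y + g y) x = S.transOp π f x + S.transOp π g x := by
  simp only [transOp, lintegral_add_left hf]
  exact lintegral_add_left
    ((hf.lintegral_kernel (κ := S.nextState)).comp measurable_prodMk_left) _

theorem transOp_const_mul (π : Policy n k) (c : ℝ≥0∞) {f : Vec n → ℝ≥0∞} (hf : Measurable f)
    (x : Vec n) : S.transOp π (fun y => c * f y) x = c * S.transOp π f x := by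
  simp only [transOp, lintegral_const_mul _ hf]
  exact lintegral_const_mul _
    ((hf.lintegral_kernel (κ := S.nextState)).comp measurable_prodMk_left)

theorem transOp_finset_sum (π : Policy n k) (s : Finset ℕ) {f : ℕ → Vec n → ℝ≥0∞}
    (hf : ∀ t, Measurable (f t)) (x : Vec n) :
    S.transOp π (fun y => ∑ t ∈ s, f t y) x = ∑ t ∈ s, S.transOp π (f t) x := by
  induction s using Finset.induction_on with
  | empty => simp [transOp_const]
  | insert a s ha ih => simp only [Finset.sum_insert ha, transOp_add S π (hf a), ih]

theorem transOp_tsum (π : Policy n k) {f : ℕ → Vec n → ℝ≥0∞} (hf : ∀ t, Measurable (f t))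
    (x : Vec n) : S.transOp π (fun y => ∑' t, f t y) x = ∑' t, S.transOp π (f t) x := by
  simp only [transOp, lintegral_tsum fun t => (hf t).aemeasurable]
  exact lintegral_tsum fun t =>
    (((hf t).lintegral_kernel (κ := S.nextState)).comp measurable_prodMk_left).aemeasurable

theorem transOp_iterate_const (π : Policy n k) (c : ℝ≥0∞) (t : ℕ) :
    (S.transOp π)^[t] (fun _ => c) = fun _ => c :=
  Function.iterate_fixed (funext fun x => S.transOp_const π c x) t

theorem transOp_iterate_mono (π : Policy n k) {f g : Vec n → ℝ≥0∞} (h : ∀ x, f x ≤ g x) (t : ℕ)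
    (x : Vec n) : (S.transOp π)^[t] f x ≤ (S.transOp π)^[t] g x := by
  induction t generalizing f g with
  | zero => exact h x
  | succ t ih => exact ih (S.transOp_mono π h)

theorem transOp_iterate_add (π : Policy n k) {f g : Vec n → ℝ≥0∞} (hf : Measurable f) (t : ℕ)
    (x : Vec n) : (S.transOp π)^[t] (fun y => f y + g y) x =
      (S.transOp π)^[t] f x + (S.transOp π)^[t] g x := by
  induction t generalizing f g with
  | zero => rfl
  | succ t ih =>
    rw [Function.iterate_succ_apply, funext (S.transOp_add π hf),
      ih (S.measurable_transOp π hf)]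
    rfl

/-- The Bellman equation of a fixed policy. -/
theorem relValue_eq (π : Policy n k) (x : Vec n) :
    S.relValue π x =
      S.runningCost π x + ENNReal.ofReal S.γ * S.transOp π (S.relValue π) x := by
  have hm := fun t => S.measurable_transOp_iterate π (S.measurable_runningCost π) t
  have h : S.relValue π = fun y =>
      ∑' t, ENNReal.ofReal S.γ ^ t * (S.transOp π)^[t] (S.runningCost π) y := rfl
  rw [h, transOp_tsum _ _ fun t => (hm t).const_mul _, ← ENNReal.tsum_mul_left]
  refine (tsum_eq_zero_add' ENNReal.summable).trans ?_
  simp only [pow_zero, one_mul, Function.iterate_zero, id_eq]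
  congr 1
  refine tsum_congr fun t => ?_
  rw [transOp_const_mul _ _ _ (hm t), Function.iterate_succ_apply', pow_succ', mul_assoc]

/-- The value function of a policy is the least nonnegative supersolution of its Bellman
equation. -/
theorem relValue_le (π : Policy n k) {V : Vec n → ℝ≥0∞}
    (h : ∀ x, S.runningCost π x + ENNReal.ofReal S.γ * S.transOp π V x ≤ V x) (x : Vec n) :
    S.relValue π x ≤ V x := by
  have hm := S.measurable_runningCost π
  -- Partial sums are value iteration from zero. Only monotonicity of `transOp` is applied to `V`,
  -- so `V` need not be measurable.
  have key : ∀ T x, ∑ t ∈ Finset.range T,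
      ENNReal.ofReal S.γ ^ t * (S.transOp π)^[t] (S.runningCost π) x ≤ V x := by
    intro T
    induction T with
    | zero => simp
    | succ T ih =>
      intro x
      refine le_trans ?_ (h x)
      rw [Finset.sum_range_succ']
      simp only [pow_zero, one_mul, Function.iterate_zero, id_eq]
      rw [add_comm]
      gcongr
      refine le_trans ?_ (mul_le_mul_right (S.transOp_mono π ih x) _)
      rw [transOp_finset_sum _ _ _ fun t =>
        (S.measurable_transOp_iterate π hm t).const_mul _, Finset.mul_sum]
      refine Finset.sum_le_sum fun t _ => le_of_eq ?_
      rw [transOp_const_mul _ _ _ (S.measurable_transOp_iterate π hm t),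
        Function.iterate_succ_apply', pow_succ', mul_assoc]
  exact ENNReal.tsum_le_of_sum_range_le fun T => key T x

end LQC

/-- Finiteness of `b` excludes `⊤ - ⊤`, and an infinite `u` forces `a` to be infinite; otherwise
everything is real. -/
theorem EReal.coe_ennreal_sub_coe_ennreal_eq {a b u : ℝ≥0∞} {c d : ℝ} (hc : 0 ≤ c) (hd : 0 ≤ d)
    (hb : b ≠ ⊤) (h : a + ENNReal.ofReal c = b + (u + ENNReal.ofReal d)) :
    (a : EReal) - (b : EReal) = (u : EReal) - ((c - d : ℝ) : EReal) := by
  lift b to ℝ≥0 using hb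
  rcases eq_or_ne u ⊤ with rfl | hu
  · have ha : a = ⊤ := by simpa using h
    subst ha
    rw [EReal.coe_ennreal_top]
    exact (EReal.top_sub_coe (b : ℝ)).trans (EReal.top_sub_coe _).symm
  lift u to ℝ≥0 using hu
  have ha : a ≠ ⊤ := by
    rintro rfl
    rw [top_add] at h
    exact (by finiteness : (b : ℝ≥0∞) + (u + ENNReal.ofReal d) ≠ ⊤) h.symm
  lift a to ℝ≥0 using ha
  have h2 := congrArg ENNReal.toReal h
  rw [ENNReal.toReal_add (by finiteness) (by finiteness),
    ENNReal.toReal_add (by finiteness) (by finiteness),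
    ENNReal.toReal_add (by finiteness) (by finiteness), ENNReal.toReal_ofReal hc,
    ENNReal.toReal_ofReal hd] at h2
  simp only [ENNReal.coe_toReal] at h2
  change ((a : ℝ) : EReal) - ((b : ℝ) : EReal) = ((u : ℝ) : EReal) - _
  norm_cast
  linarith

/-! ### The value in extended reals, and Bellman operators on quadratic functions. -/

namespace LQC

variable {n k : ℕ} (S : LQC n k)

theorem tsum_discount (c : ℝ) :
    ∑' t : ℕ, ENNReal.ofReal S.γ ^ t * ENNReal.ofReal c = ENNReal.ofReal (c / (1 - S.γ)) := by
  have h1 := S.γ_pos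
  have h2 := S.γ_lt_one
  rw [ENNReal.tsum_mul_right, ENNReal.tsum_geometric, ← ENNReal.ofReal_one,
    ← ENNReal.ofReal_sub _ h1.le, ← ENNReal.ofReal_inv_of_pos (by linarith),
    ← ENNReal.ofReal_mul (inv_nonneg.2 (by linarith)), inv_mul_eq_div]

theorem lintegral_tsum_discount (π : Policy n k) (x : Vec n) {c : Vec n × Vec k → ℝ}
    (hc : Measurable c) :
    ∫⁻ ω, ∑' t, ENNReal.ofReal (S.γ ^ t * c (ω t)) ∂S.trajLaw π x =
      ∑' t, ENNReal.ofReal S.γ ^ t *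
        (S.transOp π)^[t] (fun y => ∫⁻ u, ENNReal.ofReal (c (y, u)) ∂π.kernel y) x := by
  have hm : ∀ t, Measurable fun ω : ℕ → Vec n × Vec k => ENNReal.ofReal (S.γ ^ t * c (ω t)) :=
    fun t => by fun_prop
  rw [lintegral_tsum fun t => (hm t).aemeasurable]
  refine tsum_congr fun t => ?_
  rw [← S.lintegral_trajLaw_eval π x t (F := fun z => ENNReal.ofReal (c z)) (by fun_prop),
    ← lintegral_const_mul _ (by fun_prop)]
  refine lintegral_congr fun ω => ?_
  rw [ENNReal.ofReal_mul (pow_nonneg S.γ_pos.le _), ENNReal.ofReal_pow S.γ_pos.le]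

/-- The value of a policy is its normalized value up to an additive constant. -/
theorem value_eq (π : Policy n k) (x : Vec n) :
    S.value π x =
      (S.relValue π x : EReal) - ((S.τ * S.logPartition 0 / (1 - S.γ) : ℝ) : EReal) := by
  have hτ := S.τ_pos
  have hγ : 0 < 1 - S.γ := by linarith [S.γ_lt_one]
  set D := S.τ * S.logPartition 0 with hD
  have hcm := S.measurable_stageCost π
  let a : Vec n → ℝ≥0∞ := fun y => ∫⁻ u, ENNReal.ofReal (S.stageCost π (y, u)) ∂π.kernel y
  let b : Vec n → ℝ≥0∞ := fun y => ∫⁻ u, ENNReal.ofReal (-S.stageCost π (y, u)) ∂π.kernel y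
  have ha : Measurable a := Measurable.lintegral_kernel_prod_right'
    (f := fun p => ENNReal.ofReal (S.stageCost π p)) (by fun_prop)
  have hb : Measurable b := Measurable.lintegral_kernel_prod_right'
    (f := fun p => ENNReal.ofReal (-S.stageCost π p)) (by fun_prop)
  have hg := S.measurable_runningCost π
  have hval : S.value π x =
      ((∑' t, ENNReal.ofReal S.γ ^ t * (S.transOp π)^[t] a x : ℝ≥0∞) : EReal) -
        ((∑' t, ENNReal.ofReal S.γ ^ t * (S.transOp π)^[t] b x : ℝ≥0∞) : EReal) := by
    rw [value, expectedSeries]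
    have e1 := S.lintegral_tsum_discount π x hcm
    have e2 := S.lintegral_tsum_discount π x hcm.neg
    simp only [Pi.neg_apply, mul_neg] at e2
    rw [e1, e2]
  have hiter : ∀ t, (S.transOp π)^[t] a x + ENNReal.ofReal (S.τ + max D 0) =
      (S.transOp π)^[t] b x + ((S.transOp π)^[t] (S.runningCost π) x +
        ENNReal.ofReal (S.τ + max (-D) 0)) := by
    intro t
    have h : ∀ y, a y + ENNReal.ofReal (S.τ + max D 0) =
        b y + (S.runningCost π y + ENNReal.ofReal (S.τ + max (-D) 0)) := by
      intro y
      have := S.lintegral_stageCost_pos_add π y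
      rw [ENNReal.ofReal_add hτ.le (le_max_right _ _), ENNReal.ofReal_add hτ.le (le_max_right _ _),
        ENNReal.ofReal_max, ENNReal.ofReal_max, ENNReal.ofReal_zero, max_eq_left zero_le,
        max_eq_left zero_le]
      exact this
    have h2 := congrFun (congrArg (fun f => (S.transOp π)^[t] f) (funext h)) x
    simpa only [S.transOp_iterate_add π ha, S.transOp_iterate_add π hb,
      S.transOp_iterate_add π hg, S.transOp_iterate_const] using h2
  have hsum : ∑' t, ENNReal.ofReal S.γ ^ t * _ = ∑' t, ENNReal.ofReal S.γ ^ t * _ :=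
    tsum_congr fun t => congrArg (fun c => ENNReal.ofReal S.γ ^ t * c) (hiter t)
  simp only [mul_add, ENNReal.tsum_add, tsum_discount] at hsum
  have hbfin : (∑' t, ENNReal.ofReal S.γ ^ t * (S.transOp π)^[t] b x) ≠ ⊤ := by
    have hle : ∀ y, b y ≤ ENNReal.ofReal (S.τ + max D 0) := by
      intro y
      rw [ENNReal.ofReal_add hτ.le (le_max_right _ _), ENNReal.ofReal_max, ENNReal.ofReal_zero,
        max_eq_left zero_le]
      exact S.lintegral_stageCost_neg_le π y
    refine ne_top_of_le_ne_top (ENNReal.ofReal_ne_top (r := (S.τ + max D 0) / (1 - S.γ))) ?_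
    rw [← S.tsum_discount]
    refine ENNReal.tsum_le_tsum fun t => ?_
    gcongr
    refine (S.transOp_iterate_mono π hle t x).trans_eq ?_
    rw [S.transOp_iterate_const]
  rw [hval, EReal.coe_ennreal_sub_coe_ennreal_eq (by positivity) (by positivity) hbfin hsum]
  congr 2
  rw [← sub_div, add_sub_add_left_eq_sub, max_zero_sub_max_neg_zero_eq_self]

theorem memLp_noise_coord (i : Fin n) : MemLp (fun w : Vec n => w i) 2 S.noise :=
  (EuclideanSpace.proj (𝕜 := ℝ) i).comp_memLp' S.noise_memLp

theorem integrable_noise_mul (i j : Fin n) : Integrable (fun w : Vec n => w i * w j) S.noise :=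
  (S.memLp_noise_coord i).integrable_mul (S.memLp_noise_coord j)

theorem integrable_noise_coord (i : Fin n) : Integrable (fun w : Vec n => w i) S.noise :=
  (S.memLp_noise_coord i).integrable one_le_two

theorem integral_noise_coord (i : Fin n) : ∫ w, w i ∂S.noise = 0 := by
  have h := (EuclideanSpace.proj (𝕜 := ℝ) i).integral_comp_comm
    (S.noise_memLp.integrable one_le_two)
  rw [S.noise_mean, map_zero] at h
  exact h

theorem integrable_quadForm_noise (P : Matrix (Fin n) (Fin n) ℝ) :
    Integrable (quadForm P) S.noise := by
  have h : quadForm P = fun w => ∑ i, ∑ j, P i j * (w i * w j) := funext (quadForm_eq_sum P)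
  rw [h]
  exact integrable_finsetSum _ fun i _ => integrable_finsetSum _ fun j _ =>
    (S.integrable_noise_mul i j).const_mul _

theorem integral_quadForm_noise {P : Matrix (Fin n) (Fin n) ℝ} (hP : Pᵀ = P) :
    ∫ w, quadForm P w ∂S.noise = (S.W * P).trace := by
  have hint : ∀ i j, Integrable (fun w : Vec n => P i j * (w i * w j)) S.noise := fun i j =>
    (S.integrable_noise_mul i j).const_mul _
  rw [integral_congr_ae (ae_of_all _ (quadForm_eq_sum P)), integral_finsetSum _ fun i _ =>
    integrable_finsetSum _ fun j _ => hint i j]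
  simp only [trace, diag, Matrix.mul_apply]
  refine Finset.sum_congr rfl fun i _ => ?_
  rw [integral_finsetSum _ fun j _ => hint i j]
  refine Finset.sum_congr rfl fun j _ => ?_
  rw [integral_const_mul, W, of_apply, mul_comm, ← congrFun (congrFun hP j) i, transpose_apply]

theorem trace_W_mul_nonneg {P : Matrix (Fin n) (Fin n) ℝ} (hP : P.PosSemidef) :
    0 ≤ (S.W * P).trace := by
  rw [← S.integral_quadForm_noise hP.transpose_eq]
  exact integral_nonneg hP.quadForm_nonneg

/-- The noise has mean zero, so the cross term integrates to zero and only the trace survives. -/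
theorem lintegral_quadForm_add_noise {P : Matrix (Fin n) (Fin n) ℝ} (hP : P.PosSemidef) {b : ℝ}
    (hb : 0 ≤ b) (y : Vec n) : ∫⁻ w, ENNReal.ofReal (quadForm P (y + w) + b) ∂S.noise =
      ENNReal.ofReal (quadForm P y + ((S.W * P).trace + b)) := by
  have hexp : (fun w => quadForm P (y + w) + b) =
      fun w => ((quadForm P y + b) + 2 * ∑ i, w i * (P *ᵥ y.ofLp) i) + quadForm P w := by
    funext w
    rw [quadForm_add_right hP.transpose_eq, dotProduct]
    ring
  have hl : Integrable (fun w : Vec n => ∑ i, w i * (P *ᵥ y.ofLp) i) S.noise :=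
    integrable_finsetSum _ fun i _ => (S.integrable_noise_coord i).mul_const _
  have hl0 : ∫ w : Vec n, ∑ i, w i * (P *ᵥ y.ofLp) i ∂S.noise = 0 := by
    rw [integral_finsetSum _ fun i _ => (S.integrable_noise_coord i).mul_const _]
    simp only [integral_mul_const, integral_noise_coord, zero_mul, Finset.sum_const_zero]
  have hl1 : Integrable (fun w : Vec n =>
      (quadForm P y + b) + 2 * ∑ i, w i * (P *ᵥ y.ofLp) i) S.noise :=
    (integrable_const _).add (hl.const_mul 2)
  have hint : Integrable (fun w => quadForm P (y + w) + b) S.noise := by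
    rw [hexp]
    exact hl1.add (S.integrable_quadForm_noise P)
  rw [← ofReal_integral_eq_lintegral_ofReal hint
    (ae_of_all _ fun w => add_nonneg (hP.quadForm_nonneg _) hb), hexp,
    integral_add hl1 (S.integrable_quadForm_noise P),
    integral_add (integrable_const _) (hl.const_mul 2), integral_const_mul, hl0,
    S.integral_quadForm_noise hP.transpose_eq]
  simp
  ring_nf

/-- The additive constant created by one application of the Bellman operator to `xᵀ P x`. -/
noncomputable def stageOffset (P : Matrix (Fin n) (Fin n) ℝ) : ℝ :=
  S.τ * (S.logPartition 0 - S.logPartition P) + S.γ * (S.W * P).trace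

theorem stageOffset_nonneg {P : Matrix (Fin n) (Fin n) ℝ} (hP : P.PosSemidef) :
    0 ≤ S.stageOffset P := by
  have h1 := sub_nonneg.2 (S.logPartition_le_logPartition_zero hP)
  have h2 := S.trace_W_mul_nonneg hP
  have h3 := S.γ_pos
  have h4 := S.τ_pos
  unfold stageOffset
  positivity

theorem transOp_quadForm (π : Policy n k) {P : Matrix (Fin n) (Fin n) ℝ} (hP : P.PosSemidef)
    {b : ℝ} (hb : 0 ≤ b) (x : Vec n) :
    S.transOp π (fun y => ENNReal.ofReal (quadForm P y + b)) x =
      ∫⁻ u, (π.density x u : ℝ≥0∞) *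
        ENNReal.ofReal (quadForm P (S.drift (x, u)) + ((S.W * P).trace + b)) := by
  have hq := (continuous_quadForm P).measurable
  have hd : Measurable fun u => S.drift (x, u) := S.measurable_drift.comp measurable_prodMk_left
  rw [transOp, ← π.lintegral_kernel x (by fun_prop)]
  refine lintegral_congr fun u => ?_
  rw [S.lintegral_nextState _ (by fun_prop), S.lintegral_quadForm_add_noise hP hb]

/-- The Bellman operator of a policy applied to a quadratic function is the optimal Bellman operator
plus a multiple of the relative entropy with respect to the Gaussian minimizer. -/
theorem bellman_quadForm (π : Policy n k) {P : Matrix (Fin n) (Fin n) ℝ} (hP : P.PosSemidef)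
    {b : ℝ} (hb : 0 ≤ b) (x : Vec n) :
    S.runningCost π x + ENNReal.ofReal S.γ *
        S.transOp π (fun y => ENNReal.ofReal (quadForm P y + b)) x =
      ENNReal.ofReal (quadForm (S.ric P) x + (S.stageOffset P + S.γ * b)) +
        ENNReal.ofReal S.τ * relEnt (fun u => π.density x u)
          (gaussDensity (WithLp.toLp 2 (-(S.gain P *ᵥ x.ofLp))) (S.cov P)) := by
  have hτ := S.τ_pos
  have hγ := S.γ_pos
  have hcov0 := S.posDef_cov (n := n) Matrix.PosSemidef.zero
  have hcov := S.posDef_cov hP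
  set m : Vec k := WithLp.toLp 2 (-(S.gain P *ᵥ x.ofLp)) with hm
  have hQ := S.Q_posSemidef.quadForm_nonneg x
  have hric := (S.posSemidef_ric hP).quadForm_nonneg x
  have hoff := S.stageOffset_nonneg hP
  have htr := S.trace_W_mul_nonneg hP
  -- The two entropy integrands contain different Gaussians, so each side receives `τ` times the
  -- Gaussian of the other; both have mass one and cancel after integration.
  have key : ∀ u, (((π.density x u : ℝ≥0∞) * ENNReal.ofReal (quadForm S.Q x) +
        ENNReal.ofReal S.τ * ENNReal.ofReal (π.density x u * (Real.log (π.density x u) -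
          Real.log (gaussDensity 0 (S.cov 0) u)) + gaussDensity 0 (S.cov 0) u - π.density x u)) +
        ENNReal.ofReal S.γ * ((π.density x u : ℝ≥0∞) *
          ENNReal.ofReal (quadForm P (S.drift (x, u)) + ((S.W * P).trace + b)))) +
        ENNReal.ofReal S.τ * ENNReal.ofReal (gaussDensity m (S.cov P) u) =
      ((π.density x u : ℝ≥0∞) *
          ENNReal.ofReal (quadForm (S.ric P) x + (S.stageOffset P + S.γ * b)) +
        ENNReal.ofReal S.τ * ENNReal.ofReal (π.density x u * (Real.log (π.density x u) -
          Real.log (gaussDensity m (S.cov P) u)) + gaussDensity m (S.cov P) u - π.density x u)) +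
        ENNReal.ofReal S.τ * ENNReal.ofReal (gaussDensity 0 (S.cov 0) u) := by
    intro u
    have hφ0 := gaussDensity_pos 0 hcov0 u
    have hφ := gaussDensity_pos m hcov u
    have hp : 0 ≤ (π.density x u : ℝ) := (π.density x u).2
    have hd := hP.quadForm_nonneg (S.drift (x, u))
    have hkl0 := relEnt_integrand_nonneg hp hφ0
    have hkl := relEnt_integrand_nonneg hp hφ
    have hl0 := S.log_gaussDensity Matrix.PosSemidef.zero 0 u
    have hl := S.log_gaussDensity hP m u
    have hsq := S.quadForm_stage_eq hP x u
    rw [← hm] at hsq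
    rw [hess_zero, sub_zero] at hl0
    rw [← ENNReal.ofReal_coe_nnreal]
    generalize gaussDensity 0 (S.cov 0) u = φ0, gaussDensity m (S.cov P) u = φ at *
    obtain ⟨r0, hr0⟩ : ∃ r, (π.density x u : ℝ) * (Real.log (π.density x u) - Real.log φ0)
      + φ0 - π.density x u = r := ⟨_, rfl⟩
    obtain ⟨r, hr⟩ : ∃ r, (π.density x u : ℝ) * (Real.log (π.density x u) - Real.log φ)
      + φ - π.density x u = r := ⟨_, rfl⟩
    rw [hr0] at hkl0 ⊢
    rw [hr] at hkl ⊢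
    repeat rw [← ENNReal.ofReal_mul (by positivity)]
    repeat rw [← ENNReal.ofReal_add (by positivity) (by positivity)]
    congr 1
    rw [← hr, ← hr0, stageOffset]
    linear_combination (π.density x u : ℝ) * hsq - (π.density x u : ℝ) * hl0
      + (π.density x u : ℝ) * hl
  have hint := lintegral_congr (μ := volume) key
  have hq := (continuous_quadForm P).measurable
  have hmd : Measurable fun u => S.drift (x, u) := S.measurable_drift.comp measurable_prodMk_left
  rw [lintegral_add_right _ (by fun_prop), lintegral_add_right _ (by fun_prop),
    lintegral_add_left (by fun_prop), lintegral_add_right _ (by fun_prop),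
    lintegral_add_left (by fun_prop), lintegral_density_mul_const, lintegral_density_mul_const,
    lintegral_const_mul _ (by fun_prop), lintegral_const_mul _ (by fun_prop),
    lintegral_const_mul _ (by fun_prop), lintegral_const_mul _ (by fun_prop),
    lintegral_const_mul _ (by fun_prop), lintegral_gaussDensity 0 hcov0,
    lintegral_gaussDensity m hcov, mul_one, ENNReal.add_left_inj ENNReal.ofReal_ne_top,
    ← S.transOp_quadForm π hP hb x] at hint
  exact hint

end LQC

/-! ### Lower and upper bounds by value iteration; the Gaussian minimizer. -/

namespace LQC

variable {n k : ℕ} (S : LQC n k)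

/-- The limiting additive constant of the value iteration. -/
noncomputable def relOffset (P : Matrix (Fin n) (Fin n) ℝ) : ℝ :=
  S.stageOffset P / (1 - S.γ)

theorem relOffset_nonneg {P : Matrix (Fin n) (Fin n) ℝ} (hP : P.PosSemidef) :
    0 ≤ S.relOffset P :=
  div_nonneg (S.stageOffset_nonneg hP) (by linarith [S.γ_lt_one])

theorem stageOffset_add_relOffset (P : Matrix (Fin n) (Fin n) ℝ) :
    S.stageOffset P + S.γ * S.relOffset P = S.relOffset P := by
  have : 1 - S.γ ≠ 0 := by linarith [S.γ_lt_one]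
  rw [relOffset]
  field_simp
  ring

/-- The trace of `Σ (R + γ BᵀPB)` equals `τ k / 2` and cancels the dimension term of the Gaussian
entropy. -/
theorem offset_eq {P : Matrix (Fin n) (Fin n) ℝ} (hP : P.PosSemidef) :
    S.offset P = S.relOffset P - S.τ * S.logPartition 0 / (1 - S.γ) := by
  have h := (S.posDef_hess hP).isUnit
  rw [Matrix.isUnit_iff_isUnit_det] at h
  have hdet : (0 : ℝ) ≤ (2 * Real.pi) ^ k * (S.cov P).det := by
    have := (S.posDef_cov hP).det_pos
    positivity
  have htr : (S.cov P * (S.R + S.γ • (S.Bᵀ * P * S.B))).trace = S.τ / 2 * k := by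
    change (S.cov P * S.hess P).trace = _
    rw [cov_eq, Matrix.smul_mul, Matrix.nonsing_inv_mul _ h, trace_smul, trace_one,
      Fintype.card_fin, smul_eq_mul]
  have hlog : S.logPartition P = Real.log ((2 * Real.pi) ^ k * (S.cov P).det) / 2 :=
    Real.log_sqrt hdet
  rw [offset, htr, relOffset, stageOffset, hlog]
  ring

/-- Insert the bound into the policy's Bellman equation and discard the nonnegative entropy term. -/
theorem le_relValue_of_quadForm_le (π : Policy n k) {P : Matrix (Fin n) (Fin n) ℝ}
    (hP : P.PosSemidef) {b : ℝ} (hb : 0 ≤ b)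
    (h : ∀ x, ENNReal.ofReal (quadForm P x + b) ≤ S.relValue π x) (x : Vec n) :
    ENNReal.ofReal (quadForm (S.ric P) x + (S.stageOffset P + S.γ * b)) ≤ S.relValue π x := by
  rw [S.relValue_eq π x]
  refine le_trans ?_ (add_le_add_right (mul_le_mul_right (S.transOp_mono π h x) _) _)
  rw [S.bellman_quadForm π hP hb]
  exact le_self_add

theorem posSemidef_ric_iterate (j : ℕ) : ((S.ric)^[j] 0).PosSemidef := by
  induction j with
  | zero => exact Matrix.PosSemidef.zero
  | succ j ih =>
    rw [Function.iterate_succ_apply']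
    exact S.posSemidef_ric ih

theorem quadForm_ric_iterate_le_relValue (π : Policy n k) (j : ℕ) (x : Vec n) :
    ENNReal.ofReal (quadForm ((S.ric)^[j] 0) x) ≤ S.relValue π x := by
  induction j generalizing x with
  | zero => simp
  | succ j ih =>
    have h := S.le_relValue_of_quadForm_le π (S.posSemidef_ric_iterate j) le_rfl
      (by simpa using ih) x
    refine le_trans (ENNReal.ofReal_le_ofReal ?_) h
    rw [Function.iterate_succ_apply']
    linarith [S.stageOffset_nonneg (S.posSemidef_ric_iterate j)]

theorem quadForm_add_relOffset_le_relValue (π : Policy n k) {P : Matrix (Fin n) (Fin n) ℝ}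
    (hP : P.PosSemidef) (hric : S.ric P = P)
    (h : ∀ x, ENNReal.ofReal (quadForm P x) ≤ S.relValue π x) (x : Vec n) :
    ENNReal.ofReal (quadForm P x + S.relOffset P) ≤ S.relValue π x := by
  have hγ := S.γ_pos
  have hγ1 := S.γ_lt_one
  have hb := S.relOffset_nonneg hP
  -- `relOffset P * (1 - γ ^ j)` is the `j`-th iterate from `0` of `b ↦ stageOffset P + γ b`, whose
  -- fixed point is `relOffset P`.
  have key : ∀ (j : ℕ) x, ENNReal.ofReal (quadForm P x + S.relOffset P * (1 - S.γ ^ j)) ≤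
      S.relValue π x := by
    intro j
    induction j with
    | zero => simpa using h
    | succ j ih =>
      intro x
      have hj : 0 ≤ 1 - S.γ ^ j := sub_nonneg.2 (pow_le_one₀ hγ.le hγ1.le)
      refine le_trans (le_of_eq ?_) (S.le_relValue_of_quadForm_le π hP (mul_nonneg hb hj) ih x)
      rw [hric]
      congr 2
      rw [pow_succ]
      linear_combination -S.stageOffset_add_relOffset P
  have hlim : Filter.Tendsto
      (fun j : ℕ => ENNReal.ofReal (quadForm P x + S.relOffset P * (1 - S.γ ^ j)))
      Filter.atTop (nhds (ENNReal.ofReal (quadForm P x + S.relOffset P))) := by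
    refine ENNReal.tendsto_ofReal ?_
    have := tendsto_pow_atTop_nhds_zero_of_lt_one hγ.le hγ1
    simpa using ((this.const_sub 1).const_mul (S.relOffset P)).const_add (quadForm P x)
  exact le_of_tendsto' hlim fun j => key j x

theorem kernel_eq_multivariateGaussian_iff (π : Policy n k) (x : Vec n) (m : Vec k)
    {C : Matrix (Fin k) (Fin k) ℝ} (hC : C.PosDef) :
    π.kernel x = multivariateGaussian m C ↔
      (fun u => (π.density x u : ℝ)) =ᵐ[volume] gaussDensity m C := by
  rw [π.kernel_apply, multivariateGaussian_eq_withDensity m hC,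
    withDensity_eq_iff (by fun_prop) (by fun_prop) (by simp [π.lintegral_density x])]
  refine Filter.eventually_congr (ae_of_all _ fun u => ?_)
  simp only
  rw [← ENNReal.ofReal_coe_nnreal, ENNReal.ofReal_eq_ofReal_iff (NNReal.coe_nonneg _)
    (gaussDensity_pos m hC u).le]

theorem isGaussianPolicy_iff (π : Policy n k) {P : Matrix (Fin n) (Fin n) ℝ}
    (hP : P.PosSemidef) : IsGaussianPolicy π (S.gain P) (S.cov P) ↔
      ∀ x, relEnt (fun u => π.density x u)
        (gaussDensity (WithLp.toLp 2 (-(S.gain P *ᵥ x.ofLp))) (S.cov P)) = 0 := by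
  refine forall_congr' fun x => ?_
  have hcov := S.posDef_cov hP
  rw [kernel_eq_multivariateGaussian_iff π x _ hcov]
  exact (relEnt_eq_zero_iff (by fun_prop) (by fun_prop) (fun u => NNReal.coe_nonneg _)
    (gaussDensity_pos _ hcov)).symm

theorem exists_isGaussianPolicy (K : Matrix (Fin k) (Fin n) ℝ) {C : Matrix (Fin k) (Fin k) ℝ}
    (hC : C.PosDef) : ∃ π : Policy n k, IsGaussianPolicy π K C := by
  have hcont : Continuous fun p : Vec n × Vec k =>
      gaussDensity (WithLp.toLp 2 (-(K *ᵥ p.1.ofLp))) C p.2 := by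
    have h : Continuous fun p : Vec n × Vec k =>
        quadForm C⁻¹ (p.2 - WithLp.toLp 2 (-(K *ᵥ p.1.ofLp))) :=
      (continuous_quadForm _).comp (by fun_prop)
    exact (Real.continuous_exp.comp (h.div_const 2).neg).div_const _
  refine ⟨⟨fun x u => (gaussDensity (WithLp.toLp 2 (-(K *ᵥ x.ofLp))) C u).toNNReal,
    hcont.measurable.real_toNNReal, fun x => lintegral_gaussDensity _ hC⟩, fun x => ?_⟩
  rw [kernel_eq_multivariateGaussian_iff _ x _ hC]
  exact ae_of_all _ fun u => Real.coe_toNNReal _ (gaussDensity_pos _ hC u).le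

/-- With zero entropy the right-hand side solves the policy's Bellman equation, and the value is the
least supersolution. -/
theorem relValue_le_of_isGaussianPolicy (π : Policy n k) {P : Matrix (Fin n) (Fin n) ℝ}
    (hP : P.PosSemidef) (hric : S.ric P = P)
    (hπ : IsGaussianPolicy π (S.gain P) (S.cov P)) (x : Vec n) :
    S.relValue π x ≤ ENNReal.ofReal (quadForm P x + S.relOffset P) := by
  refine S.relValue_le π (V := fun x => ENNReal.ofReal (quadForm P x + S.relOffset P))
    (fun x => ?_) x
  rw [S.bellman_quadForm π hP (S.relOffset_nonneg hP), (S.isGaussianPolicy_iff π hP).1 hπ x,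
    mul_zero, add_zero, hric, S.stageOffset_add_relOffset]

/-- Cancelling the finite quadratic part from the Bellman equation leaves `τ` times the relative
entropy equal to zero. -/
theorem isGaussianPolicy_of_relValue_eq (π : Policy n k) {P : Matrix (Fin n) (Fin n) ℝ}
    (hP : P.PosSemidef) (hric : S.ric P = P)
    (h : ∀ x, S.relValue π x = ENNReal.ofReal (quadForm P x + S.relOffset P)) :
    IsGaussianPolicy π (S.gain P) (S.cov P) := by
  rw [S.isGaussianPolicy_iff π hP]
  intro x
  have h1 := S.relValue_eq π x
  rw [funext h, S.bellman_quadForm π hP (S.relOffset_nonneg hP), hric,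
    S.stageOffset_add_relOffset] at h1
  have h2 := (ENNReal.add_right_inj ENNReal.ofReal_ne_top).1 ((add_zero _).trans h1).symm
  exact (mul_eq_zero.1 h2).resolve_left (ENNReal.ofReal_pos.2 S.τ_pos).ne'

end LQC

/-! ### Geometric decay and perturbed stable recursions. -/

section Stability

open Filter Topology

theorem tendsto_zero_of_succ_eq_mul_add {a δ : ℕ → ℝ} {r : ℝ} (hr0 : 0 ≤ r) (hr : r < 1)
    (ha : ∀ t, 0 ≤ a t) (hδ : Tendsto δ atTop (𝓝 0)) (h : ∀ t, a (t + 1) = r * a t + δ t) :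
    Tendsto a atTop (𝓝 0) := by
  rw [Metric.tendsto_atTop]
  intro ε hε
  have h1r : 0 < 1 - r := by linarith
  -- With this tolerance, `ε / 2` is the fixed point of `b ↦ r b + ε / 2 * (1 - r)`.
  obtain ⟨N, hN⟩ := (Metric.tendsto_atTop.1 hδ) (ε / 2 * (1 - r)) (by positivity)
  have hbound : ∀ s, a (N + s) ≤ ε / 2 + r ^ s * a N := by
    intro s
    induction s with
    | zero => simp; linarith
    | succ s ih =>
      have h1 := hN (N + s) (Nat.le_add_right _ _)
      rw [Real.dist_0_eq_abs] at h1
      have h2 := (abs_lt.1 h1).2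
      rw [← add_assoc, h, pow_succ]
      nlinarith [mul_le_mul_of_nonneg_left ih hr0]
  have hpow : Tendsto (fun s => r ^ s * a N) atTop (𝓝 0) := by
    simpa using (tendsto_pow_atTop_nhds_zero_of_lt_one hr0 hr).mul_const (a N)
  obtain ⟨M, hM⟩ := (Metric.tendsto_atTop.1 hpow) (ε / 2) (by positivity)
  refine ⟨N + M, fun t ht => ?_⟩
  obtain ⟨s, rfl⟩ : ∃ s, t = N + s := ⟨t - N, by omega⟩
  have h1 := hM s (by omega)
  rw [Real.dist_0_eq_abs] at h1 ⊢
  rw [abs_of_nonneg (ha _)]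
  linarith [hbound s, (abs_lt.1 h1).2]

/-- In the adapted size `sup_i r⁻ⁱ ‖Fⁱ v‖` the map `F` contracts by `r`. The scalar sequence `a`
majorizes this size along `y`, which is why `key` bounds all powers of `F` at once. -/
theorem tendsto_zero_of_perturbed_stable {E : Type*} [NormedAddCommGroup E] [NormedSpace ℝ E]
    (F : E →L[ℝ] E) {c r : ℝ} (hc : 0 ≤ c) (hr0 : 0 ≤ r) (hr : r < 1)
    (hF : ∀ i v, ‖(F ^ i) v‖ ≤ c * r ^ i * ‖v‖) {y ε : ℕ → E}
    (hε : Tendsto ε atTop (𝓝 0)) (hy : ∀ t, y (t + 1) = F (y t) + ε t) :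
    Tendsto y atTop (𝓝 0) := by
  let a : ℕ → ℝ := fun t => Nat.rec (c * ‖y 0‖) (fun t b => r * b + c * ‖ε t‖) t
  have ha : ∀ t, a (t + 1) = r * a t + c * ‖ε t‖ := fun t => rfl
  have ha0 : ∀ t, 0 ≤ a t := by
    intro t
    induction t with
    | zero => exact mul_nonneg hc (norm_nonneg _)
    | succ t ih => rw [ha]; positivity
  have hδ : Tendsto (fun t => c * ‖ε t‖) atTop (𝓝 0) := by
    simpa using hε.norm.const_mul c
  have key : ∀ t i, ‖(F ^ i) (y t)‖ ≤ r ^ i * a t := by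
    intro t
    induction t with
    | zero =>
      intro i
      refine (hF i (y 0)).trans_eq ?_
      change _ = r ^ i * (c * ‖y 0‖)
      ring
    | succ t ih =>
      intro i
      rw [hy, map_add, ha]
      have h1 : (F ^ i) (F (y t)) = (F ^ (i + 1)) (y t) := by rw [pow_succ]; rfl
      rw [h1]
      refine (norm_add_le _ _).trans ?_
      refine (add_le_add (ih (i + 1)) (hF i (ε t))).trans_eq ?_
      ring
  refine squeeze_zero_norm (a := a) (fun t => by simpa using key t 0) ?_
  exact tendsto_zero_of_succ_eq_mul_add hr0 hr ha0 hδ ha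

/-- Powers of an element of a complex Banach algebra decay geometrically, up to a scaling factor
that is smaller than the inverse of the spectral radius. -/
theorem exists_pow_norm_le_of_spectrum {A : Type*} [NormedRing A] [NormedAlgebra ℂ A]
    [CompleteSpace A] (a : A) {s : ℝ} (hs : 0 < s) (h : ∀ z ∈ spectrum ℂ a, s * ‖z‖ < 1) :
    ∃ c r : ℝ, 0 ≤ c ∧ 0 ≤ r ∧ r < 1 ∧ ∀ t, s ^ t * ‖a ^ t‖ ≤ c * r ^ t := by
  have hρ : spectralRadius ℂ a < ((s⁻¹).toNNReal : ℝ≥0∞) := by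
    -- The algebra may be trivial, as for `0 × 0` matrices, and then the spectrum is empty.
    rcases (spectrum ℂ a).eq_empty_or_nonempty with he | hne
    · simp [spectralRadius, he, hs]
    · refine spectrum.spectralRadius_lt_of_forall_lt_of_nonempty hne fun z hz => ?_
      rw [← NNReal.coe_lt_coe, Real.coe_toNNReal _ (inv_nonneg.2 hs.le), coe_nnnorm,
        ← one_div, lt_div_iff₀' hs]
      exact h z hz
  obtain ⟨q, hq1, hq2⟩ := ENNReal.lt_iff_exists_nnreal_btwn.1 hρ
  have hq0 : 0 < q := by
    have := (zero_le (a := spectralRadius ℂ a)).trans_lt hq1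
    exact_mod_cast this
  have hsq : s * q < 1 := by
    have h2 : q < (s⁻¹).toNNReal := by exact_mod_cast hq2
    rw [← NNReal.coe_lt_coe, Real.coe_toNNReal _ (inv_nonneg.2 hs.le)] at h2
    calc s * q < s * s⁻¹ := by gcongr
      _ = 1 := mul_inv_cancel₀ hs.ne'
  -- Gelfand's formula, with `q` strictly between the spectral radius and `s⁻¹`.
  have hev : ∀ᶠ t : ℕ in atTop, ‖a ^ t‖ ≤ (q : ℝ) ^ t := by
    have hlim := spectrum.pow_nnnorm_pow_one_div_tendsto_nhds_spectralRadius a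
    filter_upwards [hlim.eventually_lt_const hq1, eventually_gt_atTop 0] with t ht ht0
    have ht0' : (0 : ℝ) < t := by exact_mod_cast ht0
    have h1 := ENNReal.rpow_le_rpow ht.le ht0'.le
    rw [← ENNReal.rpow_mul, one_div_mul_cancel ht0'.ne', ENNReal.rpow_one,
      ENNReal.rpow_natCast] at h1
    exact_mod_cast h1
  have hO : (fun t => ‖a ^ t‖) =O[atTop] fun t : ℕ => (q : ℝ) ^ t := by
    refine Asymptotics.IsBigO.of_bound 1 ?_
    filter_upwards [hev] with t ht
    simpa using ht
  obtain ⟨c, hc, hb⟩ := Asymptotics.bound_of_isBigO_nat_atTop hO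
  refine ⟨c, s * q, hc.le, by positivity, hsq, fun t => ?_⟩
  have hqt : (q : ℝ) ^ t ≠ 0 := by positivity
  have h1 := hb hqt
  rw [norm_norm, Real.norm_of_nonneg (by positivity : (0 : ℝ) ≤ (q : ℝ) ^ t)] at h1
  calc s ^ t * ‖a ^ t‖ ≤ s ^ t * (c * q ^ t) := by gcongr
    _ = c * (s * q) ^ t := by rw [mul_pow]; ring

/-- `ℝᵈ` embeds isometrically in `ℂᵈ`, so spectral bounds for the complexified matrix control real
vectors. -/
theorem norm_toLp_mulVec_le {d : ℕ} (M : Matrix (Fin d) (Fin d) ℝ) (v : Vec d) :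
    ‖(WithLp.toLp 2 (M *ᵥ v.ofLp) : Vec d)‖ ≤
      ‖toEuclideanCLM (𝕜 := ℂ) (M.map (algebraMap ℝ ℂ))‖ * ‖v‖ := by
  have hι : ∀ w : Vec d, ‖(WithLp.toLp 2 fun i => (w i : ℂ) : EuclideanSpace ℂ (Fin d))‖ = ‖w‖ := by
    intro w
    simp [EuclideanSpace.norm_eq]
  have h := (toEuclideanCLM (𝕜 := ℂ) (M.map (algebraMap ℝ ℂ))).le_opNorm
    (WithLp.toLp 2 fun i => (v i : ℂ))
  rw [hι, toEuclideanCLM_toLp] at h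
  refine le_trans (le_of_eq ?_) h
  rw [← hι]
  congr 2
  funext i
  simp [mulVec, dotProduct]

theorem LQC.DiscountStable.exists_norm_pow_le {d : ℕ} {γ : ℝ} (hγ : 0 < γ)
    {M : Matrix (Fin d) (Fin d) ℝ} (hM : LQC.DiscountStable γ M) :
    ∃ c r : ℝ, 0 ≤ c ∧ 0 ≤ r ∧ r < 1 ∧ ∀ t (v : Vec d),
      √γ ^ t * ‖(WithLp.toLp 2 ((M ^ t) *ᵥ v.ofLp) : Vec d)‖ ≤ c * r ^ t * ‖v‖ := by
  have hs : 0 < √γ := Real.sqrt_pos.2 hγ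
  obtain ⟨c, r, hc, hr0, hr, h⟩ := exists_pow_norm_le_of_spectrum
    (toEuclideanCLM (𝕜 := ℂ) (M.map (algebraMap ℝ ℂ))) hs (by
      intro z hz
      rw [AlgEquiv.spectrum_eq (toEuclideanCLM (n := Fin d) (𝕜 := ℂ))] at hz
      have := hM z hz
      rw [← Real.sq_sqrt hγ.le, ← mul_pow] at this
      exact (sq_lt_one_iff₀ (by positivity)).1 this)
  refine ⟨c, r, hc, hr0, hr, fun t v => ?_⟩
  calc _ ≤ √γ ^ t * (‖toEuclideanCLM (𝕜 := ℂ) ((M ^ t).map (algebraMap ℝ ℂ))‖ * ‖v‖) := by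
        gcongr
        exact norm_toLp_mulVec_le _ _
    _ = √γ ^ t * ‖toEuclideanCLM (𝕜 := ℂ) (M.map (algebraMap ℝ ℂ)) ^ t‖ * ‖v‖ := by
        rw [← map_pow, Matrix.map_pow, mul_assoc]
    _ ≤ _ := mul_le_mul_of_nonneg_right (h t) (norm_nonneg v)

theorem exists_abs_quadForm_le {d : ℕ} (M : Matrix (Fin d) (Fin d) ℝ) :
    ∃ c : ℝ, 0 ≤ c ∧ ∀ v : Vec d, |quadForm M v| ≤ c * ‖v‖ ^ 2 := by
  refine ⟨‖toEuclideanCLM (𝕜 := ℝ) M‖, norm_nonneg _, fun v => ?_⟩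
  have h1 : quadForm M v = inner ℝ v (toEuclideanCLM (𝕜 := ℝ) M v) :=
    (inner_toEuclideanCLM M v v).symm
  rw [h1]
  refine (abs_real_inner_le_norm _ _).trans ?_
  have := (toEuclideanCLM (𝕜 := ℝ) M).le_opNorm v
  nlinarith [norm_nonneg v, mul_le_mul_of_nonneg_left this (norm_nonneg v)]

-- With `C = √M`, the form is `‖C v‖²` and `M v = C (C v)`.
open scoped MatrixOrder in
theorem Matrix.PosSemidef.tendsto_mulVec_zero {d : ℕ} {M : Matrix (Fin d) (Fin d) ℝ}
    (hM : M.PosSemidef) {y : ℕ → Vec d}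
    (h : Tendsto (fun t => quadForm M (y t)) atTop (𝓝 0)) :
    Tendsto (fun t => toEuclideanCLM (𝕜 := ℝ) M (y t)) atTop (𝓝 0) := by
  obtain ⟨C, hCt, hC⟩ : ∃ C : Matrix (Fin d) (Fin d) ℝ, Cᵀ = C ∧ C * C = M :=
    ⟨CFC.sqrt M, (Matrix.nonneg_iff_posSemidef.1 (CFC.sqrt_nonneg M)).transpose_eq,
      CFC.sqrt_mul_sqrt_self M hM.nonneg⟩
  have hq : ∀ v : Vec d, quadForm M v = ‖toEuclideanCLM (𝕜 := ℝ) C v‖ ^ 2 := by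
    intro v
    have h1 : M = Cᵀ * 1 * C := by rw [Matrix.mul_one, hCt, hC]
    rw [h1, quadForm_transpose_mul_mul, quadForm, one_mulVec, EuclideanSpace.real_norm_sq_eq]
    simp [dotProduct, sq]
  have h1 : Tendsto (fun t => toEuclideanCLM (𝕜 := ℝ) C (y t)) atTop (𝓝 0) := by
    rw [tendsto_zero_iff_norm_tendsto_zero]
    have h2 := (Real.continuous_sqrt.tendsto 0).comp h
    simpa [Function.comp_def, hq] using h2
  have h2 := ((toEuclideanCLM (𝕜 := ℝ) C).continuous.tendsto 0).comp h1
  rw [map_zero] at h2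
  refine h2.congr fun t => ?_
  rw [← hC, map_mul]
  rfl

end Stability

/-! ### Convergence of the Riccati iteration; stabilizability and detectability. -/

namespace LQC

open Filter Topology

variable {n k : ℕ} (S : LQC n k)

theorem quadForm_ric_iterate_mono (x : Vec n) :
    Monotone fun j => quadForm ((S.ric)^[j] 0) x := by
  refine monotone_nat_of_le_succ fun j => ?_
  induction j generalizing x with
  | zero => simpa using (S.posSemidef_ric_iterate 1).quadForm_nonneg x
  | succ j ih =>
    rw [Function.iterate_succ_apply', Function.iterate_succ_apply' _ (j + 1)]
    exact S.quadForm_ric_mono (S.posSemidef_ric_iterate j) ih x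

theorem quadForm_ric_iterate_le {P : Matrix (Fin n) (Fin n) ℝ} (hP : P.PosSemidef)
    (hric : S.ric P = P) (j : ℕ) (x : Vec n) : quadForm ((S.ric)^[j] 0) x ≤ quadForm P x := by
  induction j generalizing x with
  | zero => simpa using hP.quadForm_nonneg x
  | succ j ih =>
    rw [Function.iterate_succ_apply', ← hric]
    exact S.quadForm_ric_mono (S.posSemidef_ric_iterate j) ih x

theorem continuousAt_ric {P : Matrix (Fin n) (Fin n) ℝ} (hP : P.PosSemidef) :
    ContinuousAt S.ric P := by
  have hdet := (S.posDef_hess hP).det_pos.ne'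
  have hhess : ContinuousAt S.hess P := by
    unfold hess
    fun_prop
  have hinv : ContinuousAt (fun P => (S.hess P)⁻¹) P :=
    ContinuousAt.comp (f := S.hess) (g := Inv.inv)
      (continuousAt_matrix_inv _ (by
        rw [Ring.inverse_eq_inv']
        exact continuousAt_inv₀ hdet)) hhess
  have hgain : ContinuousAt S.gain P := by
    change ContinuousAt (fun P => S.γ • ((S.hess P)⁻¹ * S.Bᵀ * P * S.A)) P
    fun_prop
  unfold ric
  fun_prop

/-- Monotone convergence of the value iteration for the Riccati equation. -/
theorem exists_tendsto_ric_iterate {b : Vec n → ℝ}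
    (hb : ∀ j x, quadForm ((S.ric)^[j] 0) x ≤ b x) :
    ∃ P : Matrix (Fin n) (Fin n) ℝ, P.PosSemidef ∧ S.ric P = P ∧
      ∀ x, Tendsto (fun j => quadForm ((S.ric)^[j] 0) x) atTop (𝓝 (quadForm P x)) := by
  have hlim : ∀ x : Vec n, ∃ l, Tendsto (fun j => quadForm ((S.ric)^[j] 0) x) atTop (𝓝 l) :=
    fun x => ⟨_, tendsto_atTop_ciSup (S.quadForm_ric_iterate_mono x)
      ⟨b x, by rintro _ ⟨j, rfl⟩; exact hb j x⟩⟩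
  choose l hl using hlim
  -- The pointwise limit `l` is not yet known to be a quadratic form; polarization gives the
  -- candidate entries.
  let P : Matrix (Fin n) (Fin n) ℝ := Matrix.of fun i j =>
    (l (EuclideanSpace.single i 1 + EuclideanSpace.single j 1)
      - l (EuclideanSpace.single i 1) - l (EuclideanSpace.single j 1)) / 2
  have hP : Tendsto (fun j => (S.ric)^[j] 0) atTop (𝓝 P) := by
    refine tendsto_pi_nhds.2 fun i => tendsto_pi_nhds.2 fun i' => ?_
    refine Tendsto.congr (fun j => (entry_eq_quadForm
      (S.posSemidef_ric_iterate j).transpose_eq i i').symm) ?_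
    exact (((hl _).sub (hl _)).sub (hl _)).div_const 2
  have hquad : ∀ x, Tendsto (fun j => quadForm ((S.ric)^[j] 0) x) atTop (𝓝 (quadForm P x)) := by
    intro x
    have hc : Continuous fun M : Matrix (Fin n) (Fin n) ℝ => quadForm M x := by
      unfold quadForm
      fun_prop
    exact (hc.tendsto P).comp hP
  have hpsd : P.PosSemidef := by
    refine posSemidef_iff_quadForm.2 ⟨?_, fun v => ge_of_tendsto' (hquad v) fun j =>
      (S.posSemidef_ric_iterate j).quadForm_nonneg v⟩
    ext i j
    simp only [P, transpose_apply, of_apply]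
    rw [add_comm]
    ring
  refine ⟨P, hpsd, ?_, hquad⟩
  have h1 := (S.continuousAt_ric hpsd).tendsto.comp hP
  have h2 : Tendsto (fun j => (S.ric)^[j + 1] 0) atTop (𝓝 P) := (tendsto_add_atTop_iff_nat 1).2 hP
  simp only [Function.iterate_succ_apply'] at h2
  exact tendsto_nhds_unique h1 h2

/-- The `j`-th iterate is at most the `j`-step cost of the stabilizing feedback, and the full
discounted cost is a convergent series dominated by a geometric one. -/
theorem quadForm_ric_iterate_le_of_stabilizable (hS : S.Stabilizable) :
    ∃ b : Vec n → ℝ, ∀ j x, quadForm ((S.ric)^[j] 0) x ≤ b x := by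
  obtain ⟨K, hK⟩ := hS
  obtain ⟨c, r, hc, hr0, hr, h⟩ := hK.exists_norm_pow_le S.γ_pos
  set M := S.A - S.B * K with hM
  set G := S.Q + Kᵀ * S.R * K with hG
  obtain ⟨g, hg0, hg⟩ := exists_abs_quadForm_le G
  have hG0 : ∀ v : Vec n, 0 ≤ quadForm G v := by
    intro v
    rw [hG, quadForm_add_left, quadForm_transpose_mul_mul]
    exact add_nonneg (S.Q_posSemidef.quadForm_nonneg _)
      (S.R_posDef.posSemidef.quadForm_nonneg _)
  let f : Vec n → ℕ → ℝ := fun x t => S.γ ^ t * quadForm G (WithLp.toLp 2 ((M ^ t) *ᵥ x.ofLp))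
  have hf0 : ∀ x t, 0 ≤ f x t := fun x t => mul_nonneg (pow_nonneg S.γ_pos.le _) (hG0 _)
  have hsum : ∀ x, Summable (f x) := by
    intro x
    have hr2 : r ^ 2 < 1 := by nlinarith
    refine Summable.of_nonneg_of_le (hf0 x) (fun t => ?_)
      ((summable_geometric_of_lt_one (sq_nonneg r) hr2).mul_left (g * (c * ‖x‖) ^ 2))
    have h1 := h t x
    calc f x t ≤ S.γ ^ t * (g * ‖(WithLp.toLp 2 ((M ^ t) *ᵥ x.ofLp) : Vec n)‖ ^ 2) :=
          mul_le_mul_of_nonneg_left ((le_abs_self _).trans (hg _)) (pow_nonneg S.γ_pos.le _)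
      _ = g * (√S.γ ^ t * ‖(WithLp.toLp 2 ((M ^ t) *ᵥ x.ofLp) : Vec n)‖) ^ 2 := by
          rw [mul_pow, ← pow_mul, mul_comm t 2, pow_mul, Real.sq_sqrt S.γ_pos.le]
          ring
      _ ≤ g * (c * r ^ t * ‖x‖) ^ 2 := by gcongr
      _ = g * (c * ‖x‖) ^ 2 * (r ^ 2) ^ t := by ring
  have key : ∀ j x, quadForm ((S.ric)^[j] 0) x ≤ ∑ t ∈ Finset.range j, f x t := by
    intro j
    induction j with
    | zero => simp
    | succ j ih =>
      intro x
      rw [Function.iterate_succ_apply', Finset.sum_range_succ']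
      refine (S.quadForm_ric_le_closedLoop (S.posSemidef_ric_iterate j) K x).trans ?_
      rw [← hM, ← hG, add_comm]
      refine add_le_add ?_ (by simp [f])
      refine (mul_le_mul_of_nonneg_left (ih _) S.γ_pos.le).trans_eq ?_
      rw [Finset.mul_sum]
      refine Finset.sum_congr rfl fun t _ => ?_
      simp only [f]
      rw [mulVec_mulVec, ← pow_succ, pow_succ S.γ]
      ring
  exact ⟨fun x => ∑' t, f x t, fun j x => (key j x).trans
    ((hsum x).sum_le_tsum _ fun t _ => hf0 x t)⟩

theorem quadForm_ric_eq_closedLoop {P : Matrix (Fin n) (Fin n) ℝ} (x : Vec n) :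
    quadForm (S.ric P) x = quadForm (S.Q + (S.gain P)ᵀ * S.R * S.gain P) x +
      S.γ * quadForm P (WithLp.toLp 2 ((S.A - S.B * S.gain P) *ᵥ x.ofLp)) := by
  rw [ric, quadForm_add_left _ (S.γ • _), quadForm_smul_left, quadForm_transpose_mul_mul]

/-- Under detectability, the optimal closed loop is stable. -/
theorem tendsto_closedLoop_of_detectable (hD : S.Detectable) {P : Matrix (Fin n) (Fin n) ℝ}
    (hP : P.PosSemidef) (hric : S.ric P = P) (x : Vec n) :
    Tendsto (fun t => √S.γ ^ t • (WithLp.toLp 2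
      (((S.A - S.B * S.gain P) ^ t) *ᵥ x.ofLp) : Vec n)) atTop (𝓝 0) := by
  have hγ := S.γ_pos
  obtain ⟨L, hL⟩ := hD
  obtain ⟨c, r, hc, hr0, hr, h⟩ := hL.exists_norm_pow_le S.γ_pos
  set K := S.gain P with hK
  set M := S.A - S.B * K with hM
  set y : ℕ → Vec n := fun t => √S.γ ^ t • (WithLp.toLp 2 ((M ^ t) *ᵥ x.ofLp) : Vec n) with hy
  have hsucc : ∀ t, y (t + 1) = √S.γ • toEuclideanCLM (𝕜 := ℝ) M (y t) := by
    intro t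
    simp only [hy, map_smul, toEuclideanCLM_toLp, mulVec_mulVec, ← pow_succ', smul_smul]
  have hR : ∀ v : Vec n, quadForm (S.Q + Kᵀ * S.R * K) v =
      quadForm S.Q v + quadForm S.R (WithLp.toLp 2 (K *ᵥ v.ofLp)) := by
    intro v
    rw [quadForm_add_left, quadForm_transpose_mul_mul]
  have hQ0 := S.Q_posSemidef.quadForm_nonneg
  have hR0 := S.R_posDef.posSemidef.quadForm_nonneg
  -- The factor `√γ ^ t` in `y` absorbs the discount, so the Riccati equation telescopes and the
  -- total stage cost is at most `P (y 0)`.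
  have htel : ∀ t, quadForm P (y t) = quadForm (S.Q + Kᵀ * S.R * K) (y t)
      + quadForm P (y (t + 1)) := by
    intro t
    have h1 := S.quadForm_ric_eq_closedLoop (P := P) (y t)
    rw [hric] at h1
    rw [h1, hsucc, quadForm_smul_right P, Real.sq_sqrt hγ.le]
    rfl
  have hG : Tendsto (fun t => quadForm (S.Q + Kᵀ * S.R * K) (y t)) atTop (𝓝 0) := by
    refine Summable.tendsto_atTop_zero (summable_of_sum_range_le (c := quadForm P (y 0))
      (fun t => by rw [hR]; exact add_nonneg (hQ0 _) (hR0 _)) fun T => ?_)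
    have h1 : ∑ t ∈ Finset.range T, quadForm (S.Q + Kᵀ * S.R * K) (y t) =
        quadForm P (y 0) - quadForm P (y T) := by
      rw [← Finset.sum_range_sub' fun t => quadForm P (y t)]
      exact Finset.sum_congr rfl fun t _ => by linarith [htel t]
    rw [h1]
    linarith [hP.quadForm_nonneg (y T)]
  have hQy := S.Q_posSemidef.tendsto_mulVec_zero (y := y) (squeeze_zero (fun t => hQ0 _)
    (fun t => by rw [hR]; linarith [hR0 (WithLp.toLp 2 (K *ᵥ (y t).ofLp))]) hG)
  have hRy := S.R_posDef.posSemidef.tendsto_mulVec_zero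
    (y := fun t => WithLp.toLp 2 (K *ᵥ (y t).ofLp)) (squeeze_zero (fun t => hR0 _)
    (fun t => by rw [hR]; linarith [hQ0 (y t)]) hG)
  have hRdet : IsUnit S.R.det := (Matrix.isUnit_iff_isUnit_det _).1 S.R_posDef.isUnit
  have h1 : Tendsto (fun t => toEuclideanCLM (𝕜 := ℝ) L (toEuclideanCLM (𝕜 := ℝ) S.Q (y t)))
      atTop (𝓝 0) := by
    have h2 := ((toEuclideanCLM (𝕜 := ℝ) L).continuous.tendsto 0).comp hQy
    rwa [map_zero] at h2
  -- `R K y → 0` gives `B K y → 0` on applying `B R⁻¹`.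
  have h2 : Tendsto (fun t => (WithLp.toLp 2 ((S.B * K) *ᵥ (y t).ofLp) : Vec n)) atTop (𝓝 0) := by
    have hcont : Continuous fun v : Vec k =>
        (WithLp.toLp 2 ((S.B * S.R⁻¹) *ᵥ v.ofLp) : Vec n) := by fun_prop
    have h3 := (hcont.tendsto 0).comp hRy
    simp only [WithLp.ofLp_zero, mulVec_zero, WithLp.toLp_zero] at h3
    refine h3.congr fun t => ?_
    simp only [Function.comp, toEuclideanCLM_toLp, mulVec_mulVec]
    rw [Matrix.mul_assoc S.B, ← Matrix.mul_assoc S.R⁻¹, Matrix.nonsing_inv_mul _ hRdet,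
      Matrix.one_mul]
  have h3 := (h1.sub h2).const_smul (√S.γ)
  rw [sub_zero, smul_zero] at h3
  -- The closed loop is the stable observer map plus an error tending to zero: `(A - BK) y = (A -
  -- LQ) y + (LQ y - BK y)`.
  refine tendsto_zero_of_perturbed_stable (toEuclideanCLM (𝕜 := ℝ) (√S.γ • (S.A - L * S.Q)))
    hc hr0 hr (fun i v => ?_) h3 fun t => ?_
  · rw [← map_pow, smul_pow, map_smul, _root_.smul_apply, norm_smul, norm_pow,
      Real.norm_of_nonneg (Real.sqrt_nonneg _)]
    exact h i v
  · rw [hsucc]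
    ext i
    simp only [hM, map_smul, map_sub, map_mul, _root_.smul_apply,
      _root_.sub_apply, mul_apply_eq_comp, ← smul_add]
    simp

/-- The gain of `P` is suboptimal for `P'`, so `P' - P ≤ γ Mᵀ (P' - P) M` with `M` the closed loop
of `P`; iterating, the right side tends to zero. -/
theorem eq_of_detectable (hD : S.Detectable) {P P' : Matrix (Fin n) (Fin n) ℝ}
    (hP : P.PosSemidef) (hric : S.ric P = P) (hP' : P'.PosSemidef) (hric' : S.ric P' = P')
    (hle : ∀ x : Vec n, quadForm P x ≤ quadForm P' x) : P' = P := by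
  have hγ := S.γ_pos
  refine eq_of_quadForm_eq hP'.transpose_eq hP.transpose_eq fun x => le_antisymm ?_ (hle x)
  set M := S.A - S.B * S.gain P with hM
  have hstep : ∀ v : Vec n, quadForm (P' - P) v ≤
      S.γ * quadForm (P' - P) (WithLp.toLp 2 (M *ᵥ v.ofLp)) := by
    intro v
    have h1 := S.quadForm_ric_le_closedLoop hP' (S.gain P) v
    have h2 := S.quadForm_ric_eq_closedLoop (P := P) v
    rw [hric'] at h1
    rw [hric] at h2
    rw [quadForm_sub_left, quadForm_sub_left]
    linarith
  have hiter : ∀ t, quadForm (P' - P) x ≤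
      quadForm (P' - P) (√S.γ ^ t • (WithLp.toLp 2 ((M ^ t) *ᵥ x.ofLp) : Vec n)) := by
    intro t
    rw [quadForm_smul_right, ← pow_mul, mul_comm t 2, pow_mul, Real.sq_sqrt hγ.le]
    induction t with
    | zero => simp
    | succ t ih =>
      refine ih.trans ((mul_le_mul_of_nonneg_left (hstep _) (pow_nonneg hγ.le t)).trans_eq ?_)
      rw [mulVec_mulVec, ← pow_succ', pow_succ S.γ]
      ring
  have hlim := ((continuous_quadForm (P' - P)).tendsto 0).comp
    (S.tendsto_closedLoop_of_detectable hD hP hric x)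
  rw [quadForm_zero_right] at hlim
  have h0 := ge_of_tendsto' hlim hiter
  rw [quadForm_sub_left] at h0
  linarith

end LQC

/-! ### Transfer to the original value function, and conclusion. -/

namespace LQC

variable {n k : ℕ} (S : LQC n k)

theorem value_lt_top_iff (π : Policy n k) (x : Vec n) :
    S.value π x < ⊤ ↔ S.relValue π x ≠ ⊤ := by
  rw [value_eq]
  rcases eq_or_ne (S.relValue π x) ⊤ with h | h
  · rw [h, EReal.coe_ennreal_top, EReal.top_sub_coe]
    simp
  · lift S.relValue π x to ℝ≥0 using h with u
    simp only [ne_eq, ENNReal.coe_ne_top, not_false_eq_true, iff_true]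
    change ((u : ℝ) : EReal) - _ < ⊤
    rw [← EReal.coe_sub]
    exact EReal.coe_lt_top _

theorem le_value_iff (π : Policy n k) {P : Matrix (Fin n) (Fin n) ℝ} (hP : P.PosSemidef)
    (x : Vec n) : ((quadForm P x + S.offset P : ℝ) : EReal) ≤ S.value π x ↔
      ENNReal.ofReal (quadForm P x + S.relOffset P) ≤ S.relValue π x := by
  have hV : 0 ≤ quadForm P x + S.relOffset P :=
    add_nonneg (hP.quadForm_nonneg x) (S.relOffset_nonneg hP)
  rw [value_eq, S.offset_eq hP, ← add_sub_assoc, EReal.coe_sub,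
    ← EReal.coe_ennreal_le_coe_ennreal_iff, EReal.coe_ennreal_ofReal, max_eq_left hV]
  refine ⟨fun h => ?_, fun h => EReal.sub_le_sub h le_rfl⟩
  -- Subtracting a finite real is strictly monotone on the part of `EReal` in play.
  by_contra hlt
  exact absurd h (not_le.2 (EReal.sub_lt_sub_of_lt_of_le (not_le.1 hlt) le_rfl
    (EReal.coe_ne_bot _) (EReal.coe_ne_top _)))

theorem value_le_iff (π : Policy n k) {P : Matrix (Fin n) (Fin n) ℝ} (hP : P.PosSemidef)
    (x : Vec n) : S.value π x ≤ ((quadForm P x + S.offset P : ℝ) : EReal) ↔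
      S.relValue π x ≤ ENNReal.ofReal (quadForm P x + S.relOffset P) := by
  have hV : 0 ≤ quadForm P x + S.relOffset P :=
    add_nonneg (hP.quadForm_nonneg x) (S.relOffset_nonneg hP)
  rw [value_eq, S.offset_eq hP, ← add_sub_assoc, EReal.coe_sub,
    ← EReal.coe_ennreal_le_coe_ennreal_iff, EReal.coe_ennreal_ofReal, max_eq_left hV]
  refine ⟨fun h => ?_, fun h => EReal.sub_le_sub h le_rfl⟩
  by_contra hlt
  exact absurd h (not_le.2 (EReal.sub_lt_sub_of_lt_of_le (not_le.1 hlt) le_rfl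
    (EReal.coe_ne_bot _) (EReal.coe_ne_top _)))

theorem optimalValue_lt_top_of_riccati {P : Matrix (Fin n) (Fin n) ℝ} (hP : P.PosSemidef)
    (hric : S.ric P = P) (x : Vec n) : S.optimalValue x < ⊤ := by
  obtain ⟨π, hπ⟩ := exists_isGaussianPolicy (S.gain P) (S.posDef_cov hP)
  exact (iInf_le _ π).trans_lt ((S.value_lt_top_iff π x).2
    (ne_top_of_le_ne_top ENNReal.ofReal_ne_top
      (S.relValue_le_of_isGaussianPolicy π hP hric hπ x)))

theorem optimalValue_lt_top_of_stabilizable (hS : S.Stabilizable) (x : Vec n) :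
    S.optimalValue x < ⊤ := by
  obtain ⟨b, hb⟩ := S.quadForm_ric_iterate_le_of_stabilizable hS
  obtain ⟨P, hP, hric, -⟩ := S.exists_tendsto_ric_iterate hb
  exact S.optimalValue_lt_top_of_riccati hP hric x

/-- The policy may vary with `x`: the iterates lie below the value of every policy, and a pointwise
bound suffices for monotone convergence. -/
theorem quadForm_ric_iterate_le_of_optimalValue_lt_top (h : ∀ x : Vec n, S.optimalValue x < ⊤) :
    ∃ b : Vec n → ℝ, ∀ j x, quadForm ((S.ric)^[j] 0) x ≤ b x := by
  have hπ : ∀ x : Vec n, ∃ π : Policy n k, S.relValue π x ≠ ⊤ := by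
    intro x
    obtain ⟨π, hπ⟩ := iInf_lt_iff.1 (h x)
    exact ⟨π, (S.value_lt_top_iff π x).1 hπ⟩
  choose π hπ using hπ
  refine ⟨fun x => (S.relValue (π x) x).toReal, fun j x => ?_⟩
  exact (ENNReal.ofReal_le_iff_le_toReal (hπ x)).1 (S.quadForm_ric_iterate_le_relValue (π x) j x)

end LQC

theorem theorem1 {n k : ℕ} (S : LQC n k) :
    (S.Stabilizable → ∀ x : Vec n, S.optimalValue x < ⊤) ∧
    ((∃ P : Matrix (Fin n) (Fin n) ℝ, P.PosSemidef ∧ S.Riccati P) →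
      ∀ x : Vec n, S.optimalValue x < ⊤) ∧
    ((∀ x : Vec n, S.optimalValue x < ⊤) →
      ∃ P : Matrix (Fin n) (Fin n) ℝ,
        P.PosSemidef ∧ S.Riccati P ∧
        (∀ P' : Matrix (Fin n) (Fin n) ℝ,
          P'.PosSemidef → S.Riccati P' → (P' - P).PosSemidef) ∧
        (S.Detectable →
          ∀ P' : Matrix (Fin n) (Fin n) ℝ, P'.PosSemidef → S.Riccati P' → P' = P) ∧
        (∃ π : Policy n k, LQC.IsGaussianPolicy π (S.gain P) (S.cov P)) ∧
        (∀ π : Policy n k,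
          S.IsOptimal π ↔ LQC.IsGaussianPolicy π (S.gain P) (S.cov P)) ∧
        (∀ x : Vec n, S.optimalValue x = ((quadForm P x + S.offset P : ℝ) : EReal))) := by
  refine ⟨S.optimalValue_lt_top_of_stabilizable,
    fun ⟨P, hP, hric⟩ => S.optimalValue_lt_top_of_riccati hP hric.symm, fun h => ?_⟩
  obtain ⟨b, hb⟩ := S.quadForm_ric_iterate_le_of_optimalValue_lt_top h
  obtain ⟨P, hP, hric, hlim⟩ := S.exists_tendsto_ric_iterate hb
  have hmin : ∀ P' : Matrix (Fin n) (Fin n) ℝ, P'.PosSemidef → S.Riccati P' →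
      ∀ x : Vec n, quadForm P x ≤ quadForm P' x := fun P' hP' hric' x =>
    le_of_tendsto' (hlim x) fun j => S.quadForm_ric_iterate_le hP' hric'.symm j x
  obtain ⟨π₀, hπ₀⟩ := LQC.exists_isGaussianPolicy (S.gain P) (S.posDef_cov hP)
  have hlower : ∀ (π : Policy n k) x,
      ENNReal.ofReal (quadForm P x + S.relOffset P) ≤ S.relValue π x := fun π =>
    S.quadForm_add_relOffset_le_relValue π hP hric fun x => le_of_tendsto'
      (ENNReal.tendsto_ofReal (hlim x)) fun j => S.quadForm_ric_iterate_le_relValue π j x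
  have hopt : ∀ x : Vec n, S.optimalValue x = ((quadForm P x + S.offset P : ℝ) : EReal) := fun x =>
    le_antisymm ((iInf_le _ π₀).trans ((S.value_le_iff π₀ hP x).2
      (S.relValue_le_of_isGaussianPolicy π₀ hP hric hπ₀ x)))
      (le_iInf fun π => (S.le_value_iff π hP x).2 (hlower π x))
  refine ⟨P, hP, hric.symm, fun P' hP' hric' => ?_, fun hD P' hP' hric' =>
    S.eq_of_detectable hD hP hric hP' hric'.symm (hmin P' hP' hric'), ⟨π₀, hπ₀⟩, fun π => ?_, hopt⟩
  · exact (posSemidef_sub_iff hP.transpose_eq hP'.transpose_eq).2 (hmin P' hP' hric')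
  · refine ⟨fun hπ => ?_, fun hπ x => ?_⟩
    · refine S.isGaussianPolicy_of_relValue_eq π hP hric fun x => le_antisymm ?_ (hlower π x)
      exact (S.value_le_iff π hP x).1 ((hπ x).trans (hopt x)).le
    · rw [hopt]
      exact le_antisymm ((S.value_le_iff π hP x).2
        (S.relValue_le_of_isGaussianPolicy π hP hric hπ x))
        ((S.le_value_iff π hP x).2 (hlower π x))
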